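/- \textbf{Setting.} A single item is sold in an all-pay auction to a leader $A$ and a follower $B$. The leader's valuation $x$ and the follower's valuation $y$ are independent, with probability densities $f_1,f_2$, distribution functions $F_1,F_2$ and supports $[a_1,a_2]$, $[b_1,b_2]$, where $0\le a_1<a_2$ and $0\le b_1<b_2$. The leader commits to a (Bayesian, possibly mixed) strategy $\sigma$, which maps each valuation $x\in[a_1,a_2]$ measurably to a probability distribution over bids in $[0,\infty)$. The follower knows $\sigma$ but not $x$. Let $P_B[t]$ be the probability that the leader's bid is at most $t$ (ties are won by the follower). With valuation $y$ she submits the lowest maximizer $t\ge 0$ of $yP_B[t]-t$; let $u_B(y)=\sup_{t\ge0}(yP_B[t]-t)$. The highest bidder wins and both bidders pay their bids. The leader's expected utility $u_A(\sigma)$ is the expectation of his valuation times the indicator that he wins, minus his expected bid ($-\infty$ if the expected bid is infinite). An \emph{optimal commitment} is a strategy $\sigma$ that maximizes $u_A$ among all strategies. For a strategy $\sigma$ let $eu_B(y,x)=F_1[x]\,y-u_B(y)$ for $y\in[0,b_2]$, $x\in(a_1,a_2]$ (the equal-utility curves). The \emph{smoothing} of $\sigma$ is $x\mapsto\sup_{y\in[0,b_2]}eu_B(y,x)$,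 and the \emph{equal-bid function} of $\sigma$ maps $x\in(a_1,a_2]$ to the least $y\in[0,b_2]$ at which this supremum is attained. Let $O_2$ be the set of weakly increasing, left continuous functions $g:(a_1,a_2]\to[0,b_2]$. Each $g\in O_2$ induces the pure strategy $s_g(x)=\int_{a_1}^x f_1(t)g(t)\,dt$. \textbf{Theorem.} Suppose that $f_2$ is weakly increasing on $(b_1,b_2)$. Then the equation $b_2-t-b_2F_1[t]=0$ has exactly one solution $t_0\in\mathbb R$. If $a_1\le b_2$, then $t_0\in[a_1,a_2)$; if moreover $F_1$ is the uniform distribution on $[a_1,a_2]$, then $t_0=\dfrac{b_2a_2}{b_2+a_2-a_1}$. Put $$g^*(x)=\begin{cases}0 & x\le t_0\\ b_2 & x>t_0\end{cases}\qquad s^*_A(x)=\begin{cases}0 & x\le t_0\\ b_2(F_1[x]-F_1[t_0]) & x>t_0.\end{cases}$$ Then: \begin{enumerate} \item $g^*\in O_2$, $s_{g^*}=s^*_A$ on $[a_1,a_2]$, and $g^*$ is the unique maximizer of $g\mapsto u_A(s_g)$ over $O_2$ (uniqueness as functions on $(a_1,a_2]$). \item $s^*_A$ is an optimal commitment. \item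 For every optimal commitment $\sigma$, the smoothing of $\sigma$ equals $s^*_A$ on $(a_1,a_2]$, and the equal-bid function of $\sigma$ equals $g^*$ on $(a_1,a_2]$. \end{enumerate} -/

import Mathlib

open MeasureTheory ProbabilityTheory Set

noncomputable section

/-- Data of a two-bidder all-pay auction. The leader's valuation has density `f₁` and support
`[a₁, a₂]`, the follower's (independent) valuation has density `f₂` and support `[b₁, b₂]`. -/
structure AllPayAuction where
  a₁ : ℝ
  a₂ : ℝ
  b₁ : ℝ
  b₂ : ℝ
  f₁ : ℝ → ℝ
  f₂ : ℝ → ℝ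
  a₁_nonneg : 0 ≤ a₁
  a₁_lt_a₂ : a₁ < a₂
  b₁_nonneg : 0 ≤ b₁
  b₁_lt_b₂ : b₁ < b₂
  measurable_f₁ : Measurable f₁
  measurable_f₂ : Measurable f₂
  f₁_nonneg : ∀ x, 0 ≤ f₁ x
  f₂_nonneg : ∀ y, 0 ≤ f₂ y
  lintegral_f₁ : ∫⁻ x, ENNReal.ofReal (f₁ x) = 1
  lintegral_f₂ : ∫⁻ y, ENNReal.ofReal (f₂ y) = 1
  support_f₁ : (volume.withDensity fun x => ENNReal.ofReal (f₁ x)).support = Icc a₁ a₂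
  support_f₂ : (volume.withDensity fun y => ENNReal.ofReal (f₂ y)).support = Icc b₁ b₂

namespace AllPayAuction

variable (G : AllPayAuction)

/-- The law of the leader's valuation. -/
def law₁ : Measure ℝ := volume.withDensity fun x => ENNReal.ofReal (G.f₁ x)

/-- The law of the follower's valuation. -/
def law₂ : Measure ℝ := volume.withDensity fun y => ENNReal.ofReal (G.f₂ y)

instance : IsProbabilityMeasure G.law₁ :=
  ⟨by rw [law₁, withDensity_apply _ MeasurableSet.univ, Measure.restrict_univ, G.lintegral_f₁]⟩

instance : IsProbabilityMeasure G.law₂ :=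
  ⟨by rw [law₂, withDensity_apply _ MeasurableSet.univ, Measure.restrict_univ, G.lintegral_f₂]⟩

/-- The cumulative distribution function of the leader's valuation. -/
def F₁ (x : ℝ) : ℝ := cdf G.law₁ x

/-- A Bayesian strategy of the leader: each valuation in `[a₁, a₂]` is mapped (measurably) to a
probability distribution over nonnegative bids. Values outside `[a₁, a₂]` are irrelevant. -/
structure IsStrategy (σ : Kernel ℝ ℝ) : Prop where
  markov : IsMarkovKernel σ
  nonneg : ∀ x ∈ Icc G.a₁ G.a₂, σ x (Iio 0) = 0

/-- The distribution of the leader's bid under the strategy `σ`. -/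
def bidLaw (σ : Kernel ℝ ℝ) : Measure ℝ := G.law₁.bind σ

/-- The follower's winning probability when she bids `t`; she wins ties. -/
def followerWinProb (σ : Kernel ℝ ℝ) (t : ℝ) : ℝ := (G.bidLaw σ).real (Iic t)

/-- The expected payoff of the follower with valuation `y` who bids `t` and pays `t` in any case. -/
def followerPayoff (σ : Kernel ℝ ℝ) (y t : ℝ) : ℝ := y * G.followerWinProb σ t - t

/-- `u_B(y)`, the largest payoff that the follower with valuation `y` can get. -/
def followerUtility (σ : Kernel ℝ ℝ) (y : ℝ) : ℝ := sSup (G.followerPayoff σ y '' Ici 0)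

/-- The set `S_B(y)` of best responses of the follower with valuation `y`. -/
def bestResponses (σ : Kernel ℝ ℝ) (y : ℝ) : Set ℝ :=
  {t | 0 ≤ t ∧ ∀ s, 0 ≤ s → G.followerPayoff σ y s ≤ G.followerPayoff σ y t}

/-- The follower's bid: her lowest best response (see `isLeast_followerBid`). -/
def followerBid (σ : Kernel ℝ ℝ) (y : ℝ) : ℝ := sInf (G.bestResponses σ y)

/-- The leader's winning probability with bid `b` against the follower's best response to `σ`. -/
def leaderWinProb (σ : Kernel ℝ ℝ) (b : ℝ) : ℝ := G.law₂.real {y | G.followerBid σ y < b}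

/-- The leader's expected utility: the expected value of the item won minus the expected bid,
which is always paid. It is `⊥` if the expected bid is infinite. -/
def leaderUtility (σ : Kernel ℝ ℝ) : EReal :=
  ((∫ x, x * (∫ b, G.leaderWinProb σ b ∂(σ x)) ∂G.law₁ : ℝ) : EReal)
    - ((∫⁻ x, ∫⁻ b, ENNReal.ofReal b ∂(σ x) ∂G.law₁ : ENNReal) : EReal)

/-- `σ` is an optimal commitment of the leader, among all Bayesian strategies. -/
def IsOptimalCommitment (σ : Kernel ℝ ℝ) : Prop :=
  G.IsStrategy σ ∧ ∀ τ, G.IsStrategy τ → G.leaderUtility τ ≤ G.leaderUtility σ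

/-- The equal-utility curve `eu_B(y, x)`: the solution `t` of `u_B(y) = F₁[x] y - t`. -/
def equalUtility (σ : Kernel ℝ ℝ) (y x : ℝ) : ℝ := G.F₁ x * y - G.followerUtility σ y

/-- The smoothing of `σ`: the supremum of the equal-utility curves over `y ∈ [0, b₂]`. -/
def smoothed (σ : Kernel ℝ ℝ) (x : ℝ) : ℝ :=
  sSup ((fun y => G.equalUtility σ y x) '' Icc 0 G.b₂)

/-- The set `Y(x)` of follower types whose equal-utility curve passes through the point of the
smoothed strategy at `x`. -/
def equalBidTypes (σ : Kernel ℝ ℝ) (x : ℝ) : Set ℝ :=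
  {y | y ∈ Icc 0 G.b₂ ∧ G.equalUtility σ y x = G.smoothed σ x}

/-- `g` is the equal-bid function of `σ`: `g(x) = min Y(x)` for `x ∈ (a₁, a₂]`. -/
def IsEqualBidFunctionOf (σ : Kernel ℝ ℝ) (g : ℝ → ℝ) : Prop :=
  ∀ x ∈ Ioc G.a₁ G.a₂, IsLeast (G.equalBidTypes σ x) (g x)

/-- The feasible functions of the optimization over equal-bid functions: weakly increasing, left
continuous functions from `(a₁, a₂]` to `[0, b₂]`. -/
structure IsFeasible (g : ℝ → ℝ) : Prop where
  mem : ∀ x ∈ Ioc G.a₁ G.a₂, g x ∈ Icc 0 G.b₂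
  mono : MonotoneOn g (Ioc G.a₁ G.a₂)
  left_cont : ∀ x ∈ Ioc G.a₁ G.a₂, ContinuousWithinAt g (Iic x) x

/-- The commitment with `s(a₁) = 0` induced by `g`: `s(x) = ∫_{a₁}^x f₁(t) g(t) dt`. -/
def inducedBid (g : ℝ → ℝ) (x : ℝ) : ℝ := ∫ t in G.a₁..x, G.f₁ t * g t

variable {G}

theorem measurable_inducedBid {g : ℝ → ℝ} (hg : G.IsFeasible g) : Measurable (G.inducedBid g) := by
  have hf : Integrable G.f₁ := by
    refine ⟨G.measurable_f₁.aestronglyMeasurable, ?_⟩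
    rw [hasFiniteIntegral_iff_ofReal (Filter.Eventually.of_forall G.f₁_nonneg), G.lintegral_f₁]
    exact ENNReal.one_lt_top
  have h0 : ∀ᵐ x, x ∉ Icc G.a₁ G.a₂ → G.f₁ x = 0 := by
    have h1 : G.law₁ (Icc G.a₁ G.a₂)ᶜ = 0 := by
      rw [← G.support_f₁]; exact Measure.measure_compl_support
    rw [law₁, withDensity_apply _ measurableSet_Icc.compl,
      setLIntegral_eq_zero_iff measurableSet_Icc.compl G.measurable_f₁.ennreal_ofReal] at h1
    filter_upwards [h1] with x hx hx'
    exact le_antisymm (ENNReal.ofReal_eq_zero.1 (hx hx')) (G.f₁_nonneg x)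
  have hI : IntegrableOn (fun t => G.f₁ t * g t) (Ioc G.a₁ G.a₂) := by
    refine Integrable.mul_bdd (c := G.b₂) hf.integrableOn ?_ ?_
    · exact (aemeasurable_restrict_of_monotoneOn measurableSet_Ioc hg.mono).aestronglyMeasurable
    · refine (ae_restrict_iff' measurableSet_Ioc).2 (Filter.Eventually.of_forall fun x hx => ?_)
      rw [Real.norm_eq_abs, abs_of_nonneg (hg.mem x hx).1]
      exact (hg.mem x hx).2
  have hI' : Integrable (fun t => G.f₁ t * g t) := by
    refine (integrable_indicator_iff measurableSet_Ioc).2 hI |>.congr ?_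
    filter_upwards [h0, Measure.ae_ne volume G.a₁] with x hx hx'
    by_cases h : x ∈ Ioc G.a₁ G.a₂
    · simp [h]
    · have : x ∉ Icc G.a₁ G.a₂ := fun h2 => h ⟨lt_of_le_of_ne h2.1 (Ne.symm hx'), h2.2⟩
      simp [h, hx this]
  exact (intervalIntegral.continuous_primitive (fun a b => hI'.intervalIntegrable) _).measurable

/-- The pure strategy of the leader that bids `∫_{a₁}^x f₁(t) g(t) dt` with valuation `x`. -/
def inducedStrategy {g : ℝ → ℝ} (hg : G.IsFeasible g) : Kernel ℝ ℝ :=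
  Kernel.deterministic (G.inducedBid g) (measurable_inducedBid hg)

/-- The lowest best response exists, so that `followerBid` is what its name says. -/
theorem isLeast_followerBid {σ : Kernel ℝ ℝ} (hσ : G.IsStrategy σ) {y : ℝ} (hy : 0 ≤ y) :
    IsLeast (G.bestResponses σ y) (G.followerBid σ y) := by
  have := hσ.markov
  have : IsProbabilityMeasure (G.bidLaw σ) := by unfold bidLaw; infer_instance
  have hP : ∀ t, G.followerPayoff σ y t = y * cdf (G.bidLaw σ) t - t := fun t => by
    rw [followerPayoff, followerWinProb, cdf_eq_real]
  have husc : UpperSemicontinuous (G.followerPayoff σ y) := by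
    intro t c hc
    rw [← nhdsLE_sup_nhdsGE, Filter.eventually_sup]
    rw [hP] at hc
    constructor
    · have h1 : Filter.Tendsto (fun s : ℝ => y * cdf (G.bidLaw σ) t - s) (nhdsWithin t (Iic t))
          (nhds (y * cdf (G.bidLaw σ) t - t)) :=
        ((continuous_const.sub continuous_id).tendsto t).mono_left nhdsWithin_le_nhds
      filter_upwards [h1.eventually_lt_const hc, self_mem_nhdsWithin] with s hs hst
      rw [hP]
      have := mul_le_mul_of_nonneg_left ((cdf (G.bidLaw σ)).mono hst) hy
      linarith
    · have h2 : Filter.Tendsto (fun s : ℝ => y * cdf (G.bidLaw σ) s - s) (nhdsWithin t (Ici t))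
          (nhds (y * cdf (G.bidLaw σ) t - t)) :=
        (((cdf (G.bidLaw σ)).right_continuous t).tendsto.const_mul y).sub
          (Filter.tendsto_id.mono_left nhdsWithin_le_nhds)
      filter_upwards [h2.eventually_lt_const hc] with s hs
      rwa [hP]
  obtain ⟨m, hm, hmax⟩ := (husc.upperSemicontinuousOn (Icc 0 y)).exists_isMaxOn
    (nonempty_Icc.2 hy) isCompact_Icc
  have hout : ∀ s, 0 ≤ s → G.followerPayoff σ y s ≤ G.followerPayoff σ y m := by
    intro s hs
    by_cases hsy : s ≤ y
    · exact hmax ⟨hs, hsy⟩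
    · refine le_trans ?_ (hmax (left_mem_Icc.2 hy))
      rw [hP, hP]
      have h1 := mul_le_mul_of_nonneg_left (cdf_le_one (G.bidLaw σ) s) hy
      have h2 := mul_nonneg hy (cdf_nonneg (G.bidLaw σ) 0)
      linarith
  have hS : G.bestResponses σ y =
      Ici 0 ∩ G.followerPayoff σ y ⁻¹' Ici (G.followerPayoff σ y m) := by
    ext t
    exact ⟨fun h => ⟨h.1, h.2 m hm.1⟩, fun h => ⟨h.1, fun s hs => (hout s hs).trans h.2⟩⟩
  have hcl : IsClosed (G.bestResponses σ y) := by
    rw [hS]; exact isClosed_Ici.inter (husc.isClosed_preimage _)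
  exact ⟨hcl.csInf_mem ⟨m, hm.1, hout⟩ ⟨0, fun t h => h.1⟩,
    fun t ht => csInf_le ⟨0, fun t h => h.1⟩ ht⟩

variable (G)

/-- The step function with values `0` up to `t₀` and `b₂` beyond. -/
def stepFunction (t₀ x : ℝ) : ℝ := if x ≤ t₀ then 0 else G.b₂

/-- The strategy that bids `0` up to `t₀` and `b₂ (F₁[x] - F₁[t₀])` beyond. -/
def thresholdBid (t₀ x : ℝ) : ℝ := if x ≤ t₀ then 0 else G.b₂ * (G.F₁ x - G.F₁ t₀)

end AllPayAuction

end

/-! The bound on the leader's utility comes from spreading each bid over the follower types that it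
beats. Write `P` for the follower's winning probability as a function of her bid, `T(y)` for her bid
and `q(y) = P(T(y))`. Incentive compatibility makes `T` and `q` monotone, and the envelope formula
gives `u_B(y) = ∫₀^y q`. The types in `(0, b₂)` that lose to a bid `b` form, up to a null set, an
interval `(0, z)`. Type `z` could deviate to `b`, so `b ≥ ∫₀^z (P(b) - q(y)) dy`
(`setIntegral_sub_equilibriumWinProb_le`). Since `f₂` is increasing, these types have probability at
most `z / b₂` (`law₂_real_le_of_lower`). Thus the leader's payoff with valuation `x` and bid `b` is
at most the integral over `y` of `x / b₂ - (P(b) - q(y))`, restricted to `T(y) < b`.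

Now fix `y` and average over `(x, b)` (`integral_typeContribution_le`). Split `x / b₂` into `(x -
t₀) / b₂` and `t₀ / b₂`. The first part is at most its positive part, whatever the bids are. The
rest depends on `b` only, and by symmetry of two independent bids it is at most `c (1 - q) - (1 -
q)² / 2`, with `c = t₀ / b₂ = 1 - F₁(t₀)` by the equation for `t₀`. Completing the square leaves a
constant minus `(q(y) - F₁(t₀))² / 2`. Integration over `y` gives `leaderUtility_le`.

The threshold bid attains the constant: against it every follower type bids `0`, so the leader wins
whenever his bid is positive. Conversely, an optimal commitment has no quadratic loss, hence `u_B(y)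
= y F₁(t₀)` on `[0, b₂]`. This determines its smoothing and its equal-bid function. For induced
strategies, convexity of the bid in `F₁` recovers `g` itself
(`eqOn_stepFunction_of_thresholdValue_le`). -/

namespace MeasureTheory

/-! ### Symmetry of independent draws, and distribution functions of atomless laws. -/

/-- For two independent draws from a finite measure `ν`, the events that the second draw is at
most, respectively less than, the first one add up, by symmetry, to the whole space. -/
theorem integral_measureReal_Iic_add_Iio (ν : Measure ℝ) [IsFiniteMeasure ν] :
    ∫ b, ν.real (Iic b) ∂ν + ∫ b, ν.real (Iio b) ∂ν = ν.real univ ^ 2 := by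
  have hA : MeasurableSet {p : ℝ × ℝ | p.2 ≤ p.1} := measurableSet_le measurable_snd measurable_fst
  have hB : MeasurableSet {p : ℝ × ℝ | p.2 < p.1} := measurableSet_lt measurable_snd measurable_fst
  have h1 : ∫⁻ b, ν (Iic b) ∂ν = (ν.prod ν) {p : ℝ × ℝ | p.2 ≤ p.1} := Measure.prod_apply hA |>.symm
  have h2 : ∫⁻ b, ν (Iio b) ∂ν = (ν.prod ν) {p : ℝ × ℝ | p.2 < p.1} := Measure.prod_apply hB |>.symm
  have h3 : (ν.prod ν) {p : ℝ × ℝ | p.2 < p.1} = (ν.prod ν) {p : ℝ × ℝ | p.2 ≤ p.1}ᶜ := by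
    have h := Measure.measurePreserving_swap (μ := ν) (ν := ν)
    rw [← h.measure_preimage hB.nullMeasurableSet]
    congr 1
    ext p
    simp
  have h4 := measure_add_measure_compl (μ := ν.prod ν) hA
  rw [← h3, ← univ_prod_univ, Measure.prod_prod] at h4
  have e1 : ∫ b, ν.real (Iic b) ∂ν = ((ν.prod ν) {p : ℝ × ℝ | p.2 ≤ p.1}).toReal := by
    rw [← h1]
    refine integral_toReal ?_ (Filter.Eventually.of_forall fun _ => measure_lt_top _ _)
    exact (measurable_measure_prodMk_left hA).aemeasurable
  have e2 : ∫ b, ν.real (Iio b) ∂ν = ((ν.prod ν) {p : ℝ × ℝ | p.2 < p.1}).toReal := by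
    rw [← h2]
    refine integral_toReal ?_ (Filter.Eventually.of_forall fun _ => measure_lt_top _ _)
    exact (measurable_measure_prodMk_left hB).aemeasurable
  rw [e1, e2, ← ENNReal.toReal_add (measure_ne_top _ _) (measure_ne_top _ _), h4,
    ENNReal.toReal_mul, sq, measureReal_def]

theorem integrable_measureReal_Iic (ν ρ : Measure ℝ) [IsFiniteMeasure ν] [IsFiniteMeasure ρ] :
    Integrable (fun b => ν.real (Iic b)) ρ := by
  refine Integrable.of_bound (C := ν.real univ) ?_ (Filter.Eventually.of_forall fun b => ?_)
  · exact (Monotone.measurable fun a b hab => measureReal_mono (Iic_subset_Iic.2 hab))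
      |>.aestronglyMeasurable
  · rw [Real.norm_of_nonneg measureReal_nonneg]
    exact measureReal_mono (subset_univ _)

theorem integrable_measureReal_Iio (ν ρ : Measure ℝ) [IsFiniteMeasure ν] [IsFiniteMeasure ρ] :
    Integrable (fun b => ν.real (Iio b)) ρ := by
  refine Integrable.of_bound (C := ν.real univ) ?_ (Filter.Eventually.of_forall fun b => ?_)
  · exact (Monotone.measurable fun a b hab => measureReal_mono (Iio_subset_Iio hab))
      |>.aestronglyMeasurable
  · rw [Real.norm_of_nonneg measureReal_nonneg]
    exact measureReal_mono (subset_univ _)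

theorem restrict_Ioi_real_Iic {μ : Measure ℝ} [IsFiniteMeasure μ] {T b : ℝ} (hb : T < b) :
    (μ.restrict (Ioi T)).real (Iic b) = μ.real (Iic b) - μ.real (Iic T) := by
  rw [measureReal_restrict_apply measurableSet_Iic, inter_comm, Ioi_inter_Iic,
    ← measureReal_sdiff (Iic_subset_Iic.2 hb.le) measurableSet_Iic]
  congr 1
  ext x
  simp [and_comm]

theorem setIntegral_measureReal_Iic_sub {μ : Measure ℝ} [IsFiniteMeasure μ] (T : ℝ) :
    ∫ b in Ioi T, (μ.real (Iic b) - μ.real (Iic T)) ∂μ =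
      ∫ b, (μ.restrict (Ioi T)).real (Iic b) ∂(μ.restrict (Ioi T)) :=
  setIntegral_congr_fun measurableSet_Ioi fun _ hb => (restrict_Ioi_real_Iic hb).symm

/-- The integral is half the squared mass by symmetry of two draws, plus a nonnegative contribution
of ties. Atoms in the leader's bid law therefore only hurt him. -/
theorem half_sq_le_setIntegral_measureReal_Iic_sub (μ : Measure ℝ) [IsFiniteMeasure μ] (T : ℝ) :
    μ.real (Ioi T) ^ 2 / 2 ≤ ∫ b in Ioi T, (μ.real (Iic b) - μ.real (Iic T)) ∂μ := by
  rw [setIntegral_measureReal_Iic_sub]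
  have h := integral_measureReal_Iic_add_Iio (μ.restrict (Ioi T))
  have h2 : ∫ b, (μ.restrict (Ioi T)).real (Iio b) ∂(μ.restrict (Ioi T)) ≤
      ∫ b, (μ.restrict (Ioi T)).real (Iic b) ∂(μ.restrict (Ioi T)) :=
    integral_mono (integrable_measureReal_Iio _ _) (integrable_measureReal_Iic _ _)
      fun b => measureReal_mono Iio_subset_Iic_self
  rw [measureReal_restrict_apply_univ] at h
  linarith

theorem setIntegral_measureReal_Iic_sub_eq (μ : Measure ℝ) [IsFiniteMeasure μ] [NullSingletonClass μ]
    (T : ℝ) :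
    ∫ b in Ioi T, (μ.real (Iic b) - μ.real (Iic T)) ∂μ = μ.real (Ioi T) ^ 2 / 2 := by
  rw [setIntegral_measureReal_Iic_sub]
  have h := integral_measureReal_Iic_add_Iio (μ.restrict (Ioi T))
  have h2 : ∀ b, (μ.restrict (Ioi T)).real (Iio b) = (μ.restrict (Ioi T)).real (Iic b) :=
    fun b => measureReal_congr Iio_ae_eq_Iic
  simp_rw [h2] at h
  rw [measureReal_restrict_apply_univ] at h
  linarith

/-- The distribution function of an atomless law is continuous. -/
theorem continuous_cdf (μ : Measure ℝ) [IsProbabilityMeasure μ] [NullSingletonClass μ] :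
    Continuous (cdf μ) := by
  refine continuous_iff_continuousAt.2 fun x => ?_
  refine continuousAt_iff_continuous_left'_right'.2
    ⟨?_, ((cdf μ).right_continuous x).mono Ioi_subset_Ici_self⟩
  have h := (cdf μ).measure_singleton x
  rw [measure_cdf, measure_singleton] at h
  have h1 := ENNReal.ofReal_eq_zero.1 h.symm
  have h2 := (cdf μ).mono.leftLim_le (le_refl x)
  exact ((cdf μ).mono.continuousWithinAt_Iio_iff_leftLim_eq).2 (by linarith)

/-- `F(X)` is stochastically at least uniform for an atomless law with distribution function
`F`. -/
theorem measureReal_setOf_cdf_le (μ : Measure ℝ) [IsProbabilityMeasure μ] [NullSingletonClass μ] {c : ℝ}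
    (hc : 0 ≤ c) : μ.real {x | cdf μ x ≤ c} ≤ c := by
  rcases le_or_gt 1 c with h1 | h1
  · exact measureReal_le_one.trans h1
  rcases eq_empty_or_nonempty {x | cdf μ x ≤ c} with h | h
  · rw [h]; simpa using hc
  obtain ⟨z, hz⟩ := ((tendsto_cdf_atTop μ).eventually_const_lt h1).exists
  have hbdd : BddAbove {x | cdf μ x ≤ c} :=
    ⟨z, fun x hx => le_of_not_gt fun hzx => absurd (monotone_cdf μ hzx.le) (by
      have : cdf μ x ≤ c := hx
      linarith)⟩
  have hcl : IsClosed {x | cdf μ x ≤ c} := isClosed_le (continuous_cdf μ) continuous_const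
  have hmem : cdf μ (sSup {x | cdf μ x ≤ c}) ≤ c := hcl.csSup_mem h hbdd
  refine le_trans ?_ hmem
  rw [cdf_eq_real]
  exact measureReal_mono fun x hx => le_csSup hbdd hx

end MeasureTheory

/-! ### The laws of the two valuations. -/

namespace AllPayAuction

variable {G : AllPayAuction}

instance : NullSingletonClass G.law₁ := by unfold law₁; infer_instance

instance : NullSingletonClass G.law₂ := by unfold law₂; infer_instance

theorem F₁_eq_real (x : ℝ) : G.F₁ x = G.law₁.real (Iic x) := cdf_eq_real _ _

theorem monotone_F₁ : Monotone G.F₁ := monotone_cdf _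

theorem continuous_F₁ : Continuous G.F₁ := continuous_cdf _

theorem ae_mem_law₁ : ∀ᵐ x ∂G.law₁, x ∈ Icc G.a₁ G.a₂ := by
  have h1 : G.law₁ (Icc G.a₁ G.a₂)ᶜ = 0 := by
    rw [← G.support_f₁]; exact Measure.measure_compl_support
  exact h1

theorem ae_mem_law₂ : ∀ᵐ x ∂G.law₂, x ∈ Icc G.b₁ G.b₂ := by
  have h1 : G.law₂ (Icc G.b₁ G.b₂)ᶜ = 0 := by
    rw [← G.support_f₂]; exact Measure.measure_compl_support
  exact h1

theorem b₂_pos : 0 < G.b₂ := G.b₁_nonneg.trans_lt G.b₁_lt_b₂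

theorem F₁_of_le {x : ℝ} (hx : x ≤ G.a₁) : G.F₁ x = 0 := by
  rw [F₁_eq_real, measureReal_congr (Iio_ae_eq_Iic (μ := G.law₁)).symm]
  refine (measureReal_eq_zero_iff).2 (measure_mono_null ?_ (ae_iff.1 (ae_mem_law₁ (G := G))))
  exact fun z hz h => absurd h.1 (not_le.2 (lt_of_lt_of_le hz hx))

theorem F₁_of_ge {x : ℝ} (hx : G.a₂ ≤ x) : G.F₁ x = 1 := by
  rw [F₁_eq_real, measureReal_def, (mem_ae_iff_prob_eq_one measurableSet_Iic).1,
    ENNReal.toReal_one]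
  filter_upwards [ae_mem_law₁] with z hz using hz.2.trans hx

theorem law₁_real_Ioi (x : ℝ) : G.law₁.real (Ioi x) = 1 - G.F₁ x := by
  rw [F₁_eq_real, ← compl_Iic, probReal_compl_eq_one_sub measurableSet_Iic]

theorem law₁_real_Ioc {x z : ℝ} (h : x ≤ z) : G.law₁.real (Ioc x z) = G.F₁ z - G.F₁ x := by
  rw [F₁_eq_real, F₁_eq_real, ← measureReal_sdiff (Iic_subset_Iic.2 h) measurableSet_Iic]
  congr 1
  ext x
  simp [and_comm]

theorem strictMonoOn_F₁ : StrictMonoOn G.F₁ (Icc G.a₁ G.a₂) := by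
  intro x hx z hz hxz
  have hm : (x + z) / 2 ∈ (G.law₁).support := by
    rw [law₁, G.support_f₁]
    constructor <;> linarith [hx.1, hz.2]
  have h1 : 0 < G.law₁ (Ioc x z) :=
    (Measure.mem_support_iff_forall _).1 hm _ (Ioc_mem_nhds (by linarith) (by linarith))
  have h2 := law₁_real_Ioc (G := G) hxz.le
  have h3 : 0 < G.law₁.real (Ioc x z) := ENNReal.toReal_pos h1.ne' (measure_ne_top _ _)
  linarith

theorem integrable_f₁ : Integrable G.f₁ := by
  refine ⟨G.measurable_f₁.aestronglyMeasurable, ?_⟩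
  rw [hasFiniteIntegral_iff_ofReal (Filter.Eventually.of_forall G.f₁_nonneg), G.lintegral_f₁]
  exact ENNReal.one_lt_top

theorem integrable_f₂ : Integrable G.f₂ := by
  refine ⟨G.measurable_f₂.aestronglyMeasurable, ?_⟩
  rw [hasFiniteIntegral_iff_ofReal (Filter.Eventually.of_forall G.f₂_nonneg), G.lintegral_f₂]
  exact ENNReal.one_lt_top

theorem setIntegral_f₁ {s : Set ℝ} (hs : MeasurableSet s) : ∫ x in s, G.f₁ x = G.law₁.real s := by
  rw [measureReal_def, law₁, withDensity_apply _ hs,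
    integral_eq_lintegral_of_nonneg_ae (Filter.Eventually.of_forall G.f₁_nonneg)
      G.measurable_f₁.aestronglyMeasurable]

theorem setIntegral_f₂ {s : Set ℝ} (hs : MeasurableSet s) : ∫ x in s, G.f₂ x = G.law₂.real s := by
  rw [measureReal_def, law₂, withDensity_apply _ hs,
    integral_eq_lintegral_of_nonneg_ae (Filter.Eventually.of_forall G.f₂_nonneg)
      G.measurable_f₂.aestronglyMeasurable]

/-- If the follower's density is increasing, her law gives each initial segment of the types in
`(0, b₂)` at most the mass that the uniform law on `(0, b₂)` gives it. -/
theorem law₂_real_le_of_lower (hf₂ : MonotoneOn G.f₂ (Ioo G.b₁ G.b₂)) {L : Set ℝ}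
    (hL : MeasurableSet L) (hlow : ∀ l ∈ L, ∀ u ∈ Ioo 0 G.b₂, u ≤ l → u ∈ L)
    (hsub : L ⊆ Ioo 0 G.b₂) : G.law₂.real L ≤ volume.real L / G.b₂ := by
  have hb := G.b₂_pos
  set U := Ioo 0 G.b₂ \ L with hU
  have hUm : MeasurableSet U := measurableSet_Ioo.diff hL
  have hvol : volume.real U = G.b₂ - volume.real L := by
    rw [hU, measureReal_sdiff hsub hL (by simp), Real.volume_real_Ioo_of_le hb.le, sub_zero]
  have hlaw : G.law₂.real U = 1 - G.law₂.real L := by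
    rw [hU, measureReal_sdiff hsub hL]
    congr 1
    rw [measureReal_def, (mem_ae_iff_prob_eq_one measurableSet_Ioo).1, ENNReal.toReal_one]
    filter_upwards [ae_mem_law₂, measure_eq_zero_iff_ae_notMem.1 (measure_singleton (μ := G.law₂) G.b₂),
      measure_eq_zero_iff_ae_notMem.1 (measure_singleton (μ := G.law₂) 0)] with y hy h1 h2
    exact ⟨lt_of_le_of_ne (G.b₁_nonneg.trans hy.1) (Ne.symm h2), lt_of_le_of_ne hy.2 h1⟩
  rw [le_div_iff₀ hb]
  rcases eq_empty_or_nonempty U with hUe | hUne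
  · rw [hUe] at hvol hlaw
    simp only [measureReal_empty] at hvol hlaw
    nlinarith
  set S := Ioo G.b₁ G.b₂ with hS
  -- Monotonicity of `f₂` is known only inside `(b₁, b₂)`. Extending by `0` keeps the order on `(0,
  -- b₂)` and changes no measure.
  set h : ℝ → ℝ := S.indicator G.f₂ with hh
  have hmono : ∀ l ∈ L, ∀ u ∈ U, h l ≤ h u := by
    intro l hl u hu
    have hlu : l < u := lt_of_not_ge fun hul => hu.2 (hlow l hl u hu.1 hul)
    by_cases h1 : l ∈ S
    · have h2 : u ∈ S := ⟨h1.1.trans hlu, hu.1.2⟩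
      rw [hh, indicator_of_mem h1, indicator_of_mem h2]
      exact hf₂ h1 h2 hlu.le
    · rw [hh, indicator_of_notMem h1]
      exact indicator_nonneg (fun x _ => G.f₂_nonneg x) _
  have hint : Integrable h := integrable_f₂.indicator measurableSet_Ioo
  have hset : ∀ s, MeasurableSet s → ∫ x in s, h x = G.law₂.real s := by
    intro s hs
    rw [hh, setIntegral_indicator measurableSet_Ioo, setIntegral_f₂ (hs.inter measurableSet_Ioo)]
    refine measureReal_congr ?_
    filter_upwards [ae_mem_law₂, measure_eq_zero_iff_ae_notMem.1 (measure_singleton (μ := G.law₂) G.b₂),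
      measure_eq_zero_iff_ae_notMem.1 (measure_singleton (μ := G.law₂) G.b₁)] with y hy h1 h2
    have : y ∈ S := ⟨lt_of_le_of_ne hy.1 (Ne.symm h2), lt_of_le_of_ne hy.2 h1⟩
    exact propext ⟨fun h => h.1, fun h => ⟨h, this⟩⟩
  -- The level `k` separates the densities: `h ≤ k` on `L` and `h ≥ k` on `U`. Eliminating `k` from
  -- the two resulting mass bounds gives the claim.
  set k := sInf (h '' U) with hk
  have hbdd : BddBelow (h '' U) :=
    ⟨0, by rintro _ ⟨u, _, rfl⟩; exact indicator_nonneg (fun x _ => G.f₂_nonneg x) _⟩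
  have hLfin : volume L ≠ ⊤ := ((measure_mono hsub).trans_lt (by simp)).ne
  have hUfin : volume U ≠ ⊤ := ((measure_mono sdiff_subset).trans_lt (by simp)).ne
  have e1 : G.law₂.real L ≤ k * volume.real L := by
    rw [← hset L hL]
    calc ∫ x in L, h x ≤ ∫ _ in L, k := setIntegral_mono_on hint.integrableOn
          (integrableOn_const hLfin) hL fun l hl => le_csInf (hUne.image _) (by
            rintro _ ⟨u, hu, rfl⟩; exact hmono l hl u hu)
      _ = k * volume.real L := by rw [setIntegral_const, smul_eq_mul, mul_comm]
  have e2 : k * volume.real U ≤ G.law₂.real U := by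
    rw [← hset U hUm]
    calc k * volume.real U = ∫ _ in U, k := by rw [setIntegral_const, smul_eq_mul, mul_comm]
      _ ≤ ∫ x in U, h x := setIntegral_mono_on (integrableOn_const hUfin)
          hint.integrableOn hUm fun u hu => csInf_le hbdd (mem_image_of_mem _ hu)
  have p1 : 0 ≤ volume.real U := measureReal_nonneg
  have p2 : 0 ≤ volume.real L := measureReal_nonneg
  have e3 := mul_le_mul_of_nonneg_right e1 p1
  have e4 := mul_le_mul_of_nonneg_right e2 p2
  rw [hvol] at e3 e4
  rw [hlaw] at e4
  nlinarith

end AllPayAuction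

/-! ### The follower's best response and the envelope formula. -/

namespace AllPayAuction

variable {G : AllPayAuction} {σ : Kernel ℝ ℝ}

theorem IsStrategy.isProbabilityMeasure_bidLaw (hσ : G.IsStrategy σ) :
    IsProbabilityMeasure (G.bidLaw σ) := by
  have := hσ.markov
  unfold bidLaw
  infer_instance

theorem monotone_followerWinProb (hσ : G.IsStrategy σ) : Monotone (G.followerWinProb σ) := by
  have := hσ.isProbabilityMeasure_bidLaw
  exact fun a b hab => measureReal_mono (Iic_subset_Iic.2 hab)

theorem followerWinProb_nonneg (σ : Kernel ℝ ℝ) (t : ℝ) : 0 ≤ G.followerWinProb σ t :=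
  measureReal_nonneg

theorem followerWinProb_le_one (hσ : G.IsStrategy σ) (t : ℝ) : G.followerWinProb σ t ≤ 1 := by
  have := hσ.isProbabilityMeasure_bidLaw
  exact measureReal_le_one

theorem followerBid_nonneg (σ : Kernel ℝ ℝ) (y : ℝ) : 0 ≤ G.followerBid σ y :=
  Real.sInf_nonneg fun _ h => h.1

theorem followerBid_eq_zero {y : ℝ} (h : 0 ∈ G.bestResponses σ y) : G.followerBid σ y = 0 :=
  le_antisymm (csInf_le ⟨0, fun _ ht => ht.1⟩ h) (followerBid_nonneg _ _)

theorem followerBid_of_nonpos (hσ : G.IsStrategy σ) {y : ℝ} (hy : y ≤ 0) :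
    G.followerBid σ y = 0 := by
  refine followerBid_eq_zero ⟨le_rfl, fun s hs => ?_⟩
  have := mul_le_mul_of_nonpos_left (monotone_followerWinProb hσ hs) hy
  unfold followerPayoff
  linarith

/-- The probability of winning when the follower with valuation `y` submits her bid. -/
noncomputable def equilibriumWinProb (G : AllPayAuction) (σ : Kernel ℝ ℝ) (y : ℝ) : ℝ :=
  G.followerWinProb σ (G.followerBid σ y)

theorem monotone_followerBid (hσ : G.IsStrategy σ) : Monotone (G.followerBid σ) := by
  intro y z hyz
  rcases le_or_gt y 0 with hy | hy
  · rw [followerBid_of_nonpos hσ hy]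
    exact followerBid_nonneg _ _
  by_contra! hlt
  have h1 := isLeast_followerBid hσ hy.le
  have h2 := (isLeast_followerBid hσ (hy.le.trans hyz)).1
  -- Strict because type `y` takes her lowest best response, so a lower bid cannot be one. Adding
  -- the optimality of type `z` contradicts single crossing.
  have h3 : G.followerPayoff σ y (G.followerBid σ z) < G.followerPayoff σ y (G.followerBid σ y) := by
    by_contra! hle
    exact absurd (h1.2 ⟨h2.1, fun s hs => (h1.1.2 s hs).trans hle⟩) (not_le.2 hlt)
  have h4 := h2.2 _ h1.1.1
  have h5 := monotone_followerWinProb hσ hlt.le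
  unfold followerPayoff at h3 h4
  nlinarith

theorem monotone_equilibriumWinProb (hσ : G.IsStrategy σ) : Monotone (G.equilibriumWinProb σ) :=
  (monotone_followerWinProb hσ).comp (monotone_followerBid hσ)

theorem followerUtility_eq (hσ : G.IsStrategy σ) {y : ℝ} (hy : 0 ≤ y) :
    G.followerUtility σ y = y * G.equilibriumWinProb σ y - G.followerBid σ y := by
  have h := (isLeast_followerBid hσ hy).1
  refine IsGreatest.csSup_eq ⟨⟨_, h.1, rfl⟩, ?_⟩
  rintro _ ⟨s, hs, rfl⟩
  exact h.2 s hs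

theorem followerPayoff_le_followerUtility (hσ : G.IsStrategy σ) {y t : ℝ} (hy : 0 ≤ y)
    (ht : 0 ≤ t) : y * G.followerWinProb σ t - t ≤ G.followerUtility σ y := by
  rw [followerUtility_eq hσ hy]
  exact (isLeast_followerBid hσ hy).1.2 t ht

theorem followerUtility_le_of_forall {y c : ℝ}
    (h : ∀ t, 0 ≤ t → y * G.followerWinProb σ t - t ≤ c) : G.followerUtility σ y ≤ c := by
  refine csSup_le (nonempty_Ici.image _) ?_
  rintro _ ⟨t, ht, rfl⟩
  exact h t ht

/-- The winning probability of the follower is a subgradient of her utility. -/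
theorem followerUtility_add_le (hσ : G.IsStrategy σ) {y z : ℝ} (hy : 0 ≤ y) (hz : 0 ≤ z) :
    G.followerUtility σ y + (z - y) * G.equilibriumWinProb σ y ≤ G.followerUtility σ z := by
  have h := followerPayoff_le_followerUtility hσ hz (followerBid_nonneg (G := G) σ y)
  rw [followerUtility_eq hσ hy]
  unfold equilibriumWinProb
  linarith

theorem equilibriumWinProb_mem (hσ : G.IsStrategy σ) (y : ℝ) :
    G.equilibriumWinProb σ y ∈ Icc 0 1 :=
  ⟨followerWinProb_nonneg _ _, followerWinProb_le_one hσ _⟩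

theorem followerUtility_zero (hσ : G.IsStrategy σ) : G.followerUtility σ 0 = 0 := by
  rw [followerUtility_eq hσ le_rfl, followerBid_of_nonpos hσ le_rfl]
  ring

/-- The subgradient inequality, used at `y` and at `z`, squeezes the difference quotient between the
winning probabilities at the two types. -/
theorem hasDerivAt_followerUtility (hσ : G.IsStrategy σ) {y : ℝ} (hy : 0 < y)
    (hc : ContinuousAt (G.equilibriumWinProb σ) y) :
    HasDerivAt (G.followerUtility σ) (G.equilibriumWinProb σ y) y := by
  rw [hasDerivAt_iff_tendsto_slope]
  have h0 : ∀ᶠ z in nhdsWithin y {y}ᶜ, 0 < z := nhdsWithin_le_nhds (Ioi_mem_nhds hy)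
  have hq : Filter.Tendsto (G.equilibriumWinProb σ) (nhdsWithin y {y}ᶜ)
      (nhds (G.equilibriumWinProb σ y)) := hc.mono_left nhdsWithin_le_nhds
  have hmin := hq.min (tendsto_const_nhds (x := G.equilibriumWinProb σ y))
  have hmax := hq.max (tendsto_const_nhds (x := G.equilibriumWinProb σ y))
  rw [min_self] at hmin
  rw [max_self] at hmax
  refine tendsto_of_tendsto_of_tendsto_of_le_of_le' hmin hmax ?_ ?_
  all_goals
    filter_upwards [h0, self_mem_nhdsWithin] with z hz hzy
    have h1 := followerUtility_add_le hσ hy.le hz.le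
    have h2 := followerUtility_add_le hσ hz.le hy.le
    rw [slope_def_field]
    rcases lt_or_gt_of_ne (show z ≠ y from hzy) with hlt | hlt
  · exact (min_le_left _ _).trans ((le_div_iff_of_neg (by linarith)).2 (by linarith))
  · exact (min_le_right _ _).trans ((le_div_iff₀ (by linarith)).2 (by linarith))
  · exact ((div_le_iff_of_neg (by linarith)).2 (by linarith)).trans (le_max_right _ _)
  · exact ((div_le_iff₀ (by linarith)).2 (by linarith)).trans (le_max_left _ _)

theorem lipschitzOnWith_followerUtility (hσ : G.IsStrategy σ) :
    LipschitzOnWith 1 (G.followerUtility σ) (Ici 0) := by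
  refine LipschitzOnWith.of_le_add_mul 1 fun y hy z hz => ?_
  have h1 := followerUtility_add_le hσ (mem_Ici.1 hy) (mem_Ici.1 hz)
  have h2 := equilibriumWinProb_mem hσ y
  rw [Real.dist_eq]
  have h3 : (y - z) * G.equilibriumWinProb σ y ≤ |y - z| := by
    refine (mul_le_mul_of_nonneg_right (le_abs_self _) h2.1).trans ?_
    exact mul_le_of_le_one_right (abs_nonneg _) h2.2
  push_cast
  linarith

/-- A monotone function has countably many discontinuities, and the utility is Lipschitz and
vanishes at `0`, so the fundamental theorem of calculus applies off a countable set. -/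
theorem integral_equilibriumWinProb (hσ : G.IsStrategy σ) {y : ℝ} (hy : 0 ≤ y) :
    ∫ z in (0)..y, G.equilibriumWinProb σ z = G.followerUtility σ y := by
  rw [integral_eq_of_hasDerivAt_off_countable_of_le (G.followerUtility σ) _ hy
    (monotone_equilibriumWinProb hσ).countable_not_continuousAt
    ((lipschitzOnWith_followerUtility hσ).continuousOn.mono Icc_subset_Ici_self)
    (fun x hx => hasDerivAt_followerUtility hσ hx.1.1 (not_not.1 hx.2))
    (monotone_equilibriumWinProb hσ).intervalIntegrable, followerUtility_zero hσ, sub_zero]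

/-- Every bid of the leader is at least the area between her winning probability and those of the
follower types bidding less. -/
theorem setIntegral_sub_equilibriumWinProb_le (hσ : G.IsStrategy σ) {b : ℝ} (hb : 0 ≤ b) :
    ∫ y in Ioo 0 G.b₂ ∩ {y | G.followerBid σ y < b},
      (G.followerWinProb σ b - G.equilibriumWinProb σ y) ≤ b := by
  set L := Ioo 0 G.b₂ ∩ {y | G.followerBid σ y < b} with hL
  rcases eq_empty_or_nonempty L with h | h
  · rw [h]; simpa using hb
  have hbdd : BddAbove L := ⟨G.b₂, fun y hy => hy.1.2.le⟩
  obtain ⟨y₀, hy₀⟩ := h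
  have hz0 : 0 ≤ sSup L := hy₀.1.1.le.trans (le_csSup hbdd hy₀)
  have hzb : sSup L ≤ G.b₂ := csSup_le ⟨y₀, hy₀⟩ fun y hy => hy.1.2.le
  -- Bids are monotone in the type, so the beaten types fill an initial segment, and the integral of
  -- `q` over it is the utility of type `sSup L`.
  have hae : L =ᵐ[volume] Ioc 0 (sSup L) := by
    filter_upwards [Measure.ae_ne volume (sSup L)] with y hy
    refine propext ⟨fun h => ⟨h.1.1, le_csSup hbdd h⟩, fun h => ?_⟩
    obtain ⟨w, hw, hyw⟩ := exists_lt_of_lt_csSup ⟨y₀, hy₀⟩ (lt_of_le_of_ne h.2 hy)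
    exact ⟨⟨h.1, hyw.trans hw.1.2⟩, (monotone_followerBid hσ hyw.le).trans_lt hw.2⟩
  rw [setIntegral_congr_set hae, ← intervalIntegral.integral_of_le hz0,
    intervalIntegral.integral_sub intervalIntegrable_const
      (monotone_equilibriumWinProb hσ).intervalIntegrable, integral_equilibriumWinProb hσ hz0,
    intervalIntegral.integral_const, smul_eq_mul]
  linarith [followerPayoff_le_followerUtility hσ hz0 hb]

theorem leaderWinProb_nonneg (σ : Kernel ℝ ℝ) (b : ℝ) : 0 ≤ G.leaderWinProb σ b :=
  measureReal_nonneg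

theorem leaderWinProb_le_one (σ : Kernel ℝ ℝ) (b : ℝ) : G.leaderWinProb σ b ≤ 1 :=
  measureReal_le_one

theorem monotone_leaderWinProb (σ : Kernel ℝ ℝ) : Monotone (G.leaderWinProb σ) :=
  fun _ _ h => measureReal_mono fun _ hy => lt_of_lt_of_le hy h

theorem measurableSet_followerBid_lt (hσ : G.IsStrategy σ) (b : ℝ) :
    MeasurableSet {y | G.followerBid σ y < b} :=
  measurableSet_lt (monotone_followerBid hσ).measurable measurable_const

/-- The only place where the monotone density enters the bound: the beaten types form a lower set.
-/
theorem leaderWinProb_le (hf₂ : MonotoneOn G.f₂ (Ioo G.b₁ G.b₂)) (hσ : G.IsStrategy σ) (b : ℝ) :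
    G.leaderWinProb σ b ≤
      volume.real (Ioo 0 G.b₂ ∩ {y | G.followerBid σ y < b}) / G.b₂ := by
  refine le_trans (le_of_eq ?_) (law₂_real_le_of_lower hf₂
    (measurableSet_Ioo.inter (measurableSet_followerBid_lt hσ b))
    (fun l hl u hu hul => ⟨hu, (monotone_followerBid hσ hul).trans_lt hl.2⟩) inter_subset_left)
  refine measureReal_congr ?_
  filter_upwards [ae_mem_law₂, measure_eq_zero_iff_ae_notMem.1 (measure_singleton (μ := G.law₂) G.b₂),
    measure_eq_zero_iff_ae_notMem.1 (measure_singleton (μ := G.law₂) 0)] with y hy h1 h2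
  exact propext ⟨fun h => ⟨⟨lt_of_le_of_ne (G.b₁_nonneg.trans hy.1) (Ne.symm h2),
    lt_of_le_of_ne hy.2 h1⟩, h⟩, fun h => h.2⟩

end AllPayAuction

/-! ### The upper bound on the leader's utility. -/

namespace AllPayAuction

variable {G : AllPayAuction} {σ : Kernel ℝ ℝ}

/-- The joint law of the leader's valuation and bid. -/
noncomputable def jointLaw (G : AllPayAuction) (σ : Kernel ℝ ℝ) : Measure (ℝ × ℝ) :=
  G.law₁.compProd σ

theorem isProbabilityMeasure_jointLaw (hσ : G.IsStrategy σ) :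
    IsProbabilityMeasure (G.jointLaw σ) := by
  have := hσ.markov
  unfold jointLaw
  infer_instance

theorem ae_mem_jointLaw (hσ : G.IsStrategy σ) :
    ∀ᵐ p ∂G.jointLaw σ, p.1 ∈ Icc G.a₁ G.a₂ ∧ 0 ≤ p.2 := by
  have := hσ.markov
  have hm : MeasurableSet {p : ℝ × ℝ | p.1 ∈ Icc G.a₁ G.a₂ ∧ 0 ≤ p.2} :=
    (measurable_fst measurableSet_Icc).inter (measurable_snd measurableSet_Ici)
  refine (Measure.ae_compProd_iff hm).2 ?_
  filter_upwards [ae_mem_law₁] with x hx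
  have h : ∀ᵐ b ∂σ x, b ∉ Iio 0 := measure_eq_zero_iff_ae_notMem.1 (hσ.nonneg x hx)
  filter_upwards [h] with b hb
  exact ⟨hx, not_lt.1 hb⟩

theorem map_fst_jointLaw (hσ : G.IsStrategy σ) : (G.jointLaw σ).map Prod.fst = G.law₁ := by
  have := hσ.markov
  exact Measure.fst_compProd _ _

theorem map_snd_jointLaw (hσ : G.IsStrategy σ) : (G.jointLaw σ).map Prod.snd = G.bidLaw σ := by
  have := hσ.markov
  exact Measure.snd_compProd _ _

/-- The maximal utility of the leader: the utility of the threshold bid with threshold `t₀`. -/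
noncomputable def thresholdValue (G : AllPayAuction) (t₀ : ℝ) : ℝ :=
  ∫ x in Ioi t₀, x ∂G.law₁ - G.b₂ * (1 - G.F₁ t₀) ^ 2 / 2

theorem integrable_id_law₁ : Integrable (fun x => x) G.law₁ := by
  refine Integrable.of_bound (C := G.a₂) measurable_id.aestronglyMeasurable ?_
  filter_upwards [ae_mem_law₁] with x hx
  rw [Real.norm_of_nonneg (G.a₁_nonneg.trans hx.1)]
  exact hx.2

/-- The contribution of the follower type `y` to the leader's payoff with valuation `p.1` and bid
`p.2`, if the follower's type were uniform on `(0, b₂)`. -/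
noncomputable def typeContribution (G : AllPayAuction) (σ : Kernel ℝ ℝ) (y : ℝ) (p : ℝ × ℝ) : ℝ :=
  if G.followerBid σ y < p.2 then
    p.1 / G.b₂ - (G.followerWinProb σ p.2 - G.equilibriumWinProb σ y) else 0

theorem integrable_typeContribution_uncurry (hσ : G.IsStrategy σ) :
    Integrable (Function.uncurry (G.typeContribution σ))
      ((volume.restrict (Ioo 0 G.b₂)).prod (G.jointLaw σ)) := by
  have := isProbabilityMeasure_jointLaw hσ
  have hT := (monotone_followerBid hσ).measurable
  have hq := (monotone_equilibriumWinProb hσ).measurable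
  have hP := (monotone_followerWinProb hσ).measurable
  refine Integrable.of_bound (C := G.a₂ / G.b₂ + 1) ?_ ?_
  · refine Measurable.aestronglyMeasurable ?_
    unfold Function.uncurry typeContribution
    refine Measurable.ite (measurableSet_lt (by fun_prop) (by fun_prop)) ?_ measurable_const
    fun_prop
  · filter_upwards [Measure.quasiMeasurePreserving_snd.ae (ae_mem_jointLaw hσ)] with z hz
    have hb := G.b₂_pos
    have h1 := equilibriumWinProb_mem (G := G) hσ z.1
    have h2 := followerWinProb_nonneg (G := G) σ z.2.2
    have h3 := followerWinProb_le_one (G := G) hσ z.2.2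
    have h4 : 0 ≤ z.2.1 / G.b₂ := div_nonneg (G.a₁_nonneg.trans hz.1.1) hb.le
    have h5 : z.2.1 / G.b₂ ≤ G.a₂ / G.b₂ := div_le_div_of_nonneg_right hz.1.2 hb.le
    unfold Function.uncurry typeContribution
    rw [Real.norm_eq_abs, abs_le]
    split_ifs
    · constructor <;> linarith [h1.1, h1.2]
    · constructor <;> linarith

/-- Both the gain and the cost of a bid are charged to the types it beats: the winning probability
is at most their uniform mass, and the bid is at least the area from the envelope formula. -/
theorem payoff_le_integral_typeContribution (hf₂ : MonotoneOn G.f₂ (Ioo G.b₁ G.b₂))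
    (hσ : G.IsStrategy σ) {p : ℝ × ℝ} (h₁ : 0 ≤ p.1) (h₂ : 0 ≤ p.2) :
    p.1 * G.leaderWinProb σ p.2 - p.2 ≤ ∫ y in Ioo 0 G.b₂, G.typeContribution σ y p := by
  have hm := measurableSet_followerBid_lt hσ p.2
  have e : ∀ y, G.typeContribution σ y p = {y | G.followerBid σ y < p.2}.indicator
      (fun y => p.1 / G.b₂ - (G.followerWinProb σ p.2 - G.equilibriumWinProb σ y)) y := fun y => rfl
  simp_rw [e]
  rw [setIntegral_indicator hm]
  have hq : IntegrableOn (G.equilibriumWinProb σ) (Ioo 0 G.b₂ ∩ {y | G.followerBid σ y < p.2}) :=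
    ((monotone_equilibriumWinProb hσ).locallyIntegrable.integrableOn_isCompact
      isCompact_Icc).mono_set (inter_subset_left.trans Ioo_subset_Icc_self)
  have hfin : volume (Ioo 0 G.b₂ ∩ {y | G.followerBid σ y < p.2}) ≠ ⊤ :=
    ((measure_mono inter_subset_left).trans_lt (by simp)).ne
  have hc : ∀ c : ℝ, Integrable (fun _ => c)
      (volume.restrict (Ioo 0 G.b₂ ∩ {y | G.followerBid σ y < p.2})) :=
    fun c => integrableOn_const hfin
  have hd : IntegrableOn (fun y => G.followerWinProb σ p.2 - G.equilibriumWinProb σ y)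
      (Ioo 0 G.b₂ ∩ {y | G.followerBid σ y < p.2}) := (hc _).sub hq
  rw [integral_sub (hc _) hd, setIntegral_const, smul_eq_mul]
  have h3 := setIntegral_sub_equilibriumWinProb_le hσ h₂
  have h4 := mul_le_mul_of_nonneg_left (leaderWinProb_le hf₂ hσ p.2) h₁
  have h5 : p.1 * (volume.real (Ioo 0 G.b₂ ∩ {y | G.followerBid σ y < p.2}) / G.b₂) =
    volume.real (Ioo 0 G.b₂ ∩ {y | G.followerBid σ y < p.2}) * (p.1 / G.b₂) := by ring
  linarith

/-- Once `t₀ / b₂` is split off from `x / b₂`, valuation and bid decouple, so only the two marginals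
of the joint law matter. The choice of `t₀` makes the bid part a square centred at `F₁ t₀`. -/
theorem integral_typeContribution_le (hσ : G.IsStrategy σ) {t₀ : ℝ}
    (h₀ : G.b₂ - t₀ - G.b₂ * G.F₁ t₀ = 0) {y : ℝ}
    (hy : Integrable (G.typeContribution σ y) (G.jointLaw σ)) :
    ∫ p, G.typeContribution σ y p ∂G.jointLaw σ ≤
      G.thresholdValue t₀ / G.b₂ - (G.equilibriumWinProb σ y - G.F₁ t₀) ^ 2 / 2 := by
  have := isProbabilityMeasure_jointLaw hσ
  have := hσ.isProbabilityMeasure_bidLaw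
  have hb := G.b₂_pos
  set T := G.followerBid σ y with hT
  set φ : ℝ → ℝ := (Ioi t₀).indicator fun x => (x - t₀) / G.b₂ with hφ
  set ψ : ℝ → ℝ := (Ioi T).indicator fun b =>
    t₀ / G.b₂ - ((G.bidLaw σ).real (Iic b) - (G.bidLaw σ).real (Iic T)) with hψ
  have iφ' : Integrable (fun x => (x - t₀) / G.b₂) G.law₁ :=
    (integrable_id_law₁.sub (integrable_const _)).div_const _
  have iψ' : Integrable (fun b => (G.bidLaw σ).real (Iic b) - (G.bidLaw σ).real (Iic T))
      (G.bidLaw σ) := (integrable_measureReal_Iic _ _).sub (integrable_const _)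
  have iφ : Integrable φ G.law₁ := iφ'.indicator measurableSet_Ioi
  have iψ : Integrable ψ (G.bidLaw σ) :=
    ((integrable_const _).sub iψ').indicator measurableSet_Ioi
  have jφ : Integrable (fun p : ℝ × ℝ => φ p.1) (G.jointLaw σ) := by
    rw [← map_fst_jointLaw hσ] at iφ
    exact iφ.comp_measurable measurable_fst
  have jψ : Integrable (fun p : ℝ × ℝ => ψ p.2) (G.jointLaw σ) := by
    rw [← map_snd_jointLaw hσ] at iψ
    exact iψ.comp_measurable measurable_snd
  have eφ' : ∫ p, φ p.1 ∂G.jointLaw σ = ∫ x, φ x ∂G.law₁ := by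
    rw [← map_fst_jointLaw hσ] at iφ
    rw [← map_fst_jointLaw hσ, integral_map measurable_fst.aemeasurable iφ.aestronglyMeasurable]
  have eψ' : ∫ p, ψ p.2 ∂G.jointLaw σ = ∫ b, ψ b ∂G.bidLaw σ := by
    rw [← map_snd_jointLaw hσ] at iψ
    rw [← map_snd_jointLaw hσ, integral_map measurable_snd.aemeasurable iψ.aestronglyMeasurable]
  -- Equality fails only if the leader outbids `y` with a valuation below `t₀`, or does not outbid
  -- `y` with one above `t₀`.
  have hle : ∀ p, G.typeContribution σ y p ≤ φ p.1 + ψ p.2 := by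
    intro p
    have hψp : ψ p.2 = if T < p.2 then t₀ / G.b₂ - (G.followerWinProb σ p.2 -
      G.equilibriumWinProb σ y) else 0 := rfl
    have hφp : φ p.1 = if t₀ < p.1 then (p.1 - t₀) / G.b₂ else 0 := rfl
    rw [hψp, hφp]
    unfold typeContribution
    rw [← hT, sub_div]
    by_cases h1 : T < p.2 <;> by_cases h2 : t₀ < p.1 <;> simp only [h1, h2, if_true, if_false]
    · linarith
    · have := div_le_div_of_nonneg_right (not_lt.1 h2) hb.le
      linarith
    · have := div_le_div_of_nonneg_right h2.le hb.le
      linarith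
    · simp
  have eφ : ∫ x, φ x ∂G.law₁ = (∫ x in Ioi t₀, x ∂G.law₁ - t₀ * (1 - G.F₁ t₀)) / G.b₂ := by
    rw [hφ, integral_indicator measurableSet_Ioi, integral_div,
      integral_sub integrable_id_law₁.integrableOn (integrable_const _), setIntegral_const,
      smul_eq_mul, law₁_real_Ioi, mul_comm t₀]
  have hm : (G.bidLaw σ).real (Ioi T) = 1 - G.equilibriumWinProb σ y := by
    rw [← compl_Iic, probReal_compl_eq_one_sub measurableSet_Iic]
    rfl
  have eψ : ∫ b, ψ b ∂G.bidLaw σ ≤ t₀ / G.b₂ * (1 - G.equilibriumWinProb σ y) -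
      (1 - G.equilibriumWinProb σ y) ^ 2 / 2 := by
    rw [hψ, integral_indicator measurableSet_Ioi, integral_sub (integrable_const _)
      iψ'.integrableOn, setIntegral_const, smul_eq_mul, hm, mul_comm]
    have := half_sq_le_setIntegral_measureReal_Iic_sub (G.bidLaw σ) T
    rw [hm] at this
    linarith
  calc ∫ p, G.typeContribution σ y p ∂G.jointLaw σ
      ≤ ∫ p, (φ p.1 + ψ p.2) ∂G.jointLaw σ := integral_mono hy (jφ.add jψ) hle
    _ = ∫ x, φ x ∂G.law₁ + ∫ b, ψ b ∂G.bidLaw σ := by rw [integral_add jφ jψ, eφ', eψ']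
    _ ≤ _ := by
      rw [eφ]
      refine (add_le_add_right eψ _).trans (le_of_eq ?_)
      unfold thresholdValue
      have ht : t₀ = G.b₂ * (1 - G.F₁ t₀) := by linarith
      have e1 : t₀ / G.b₂ = 1 - G.F₁ t₀ := by rw [div_eq_iff hb.ne']; linarith
      rw [e1, sub_div, sub_div, mul_div_right_comm, e1]
      field_simp
      ring

theorem integrable_value_mul_leaderWinProb (hσ : G.IsStrategy σ) :
    Integrable (fun p : ℝ × ℝ => p.1 * G.leaderWinProb σ p.2) (G.jointLaw σ) := by
  have := isProbabilityMeasure_jointLaw hσ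
  have hW := (monotone_leaderWinProb (G := G) σ).measurable
  refine Integrable.of_bound (C := G.a₂) (by fun_prop) ?_
  filter_upwards [ae_mem_jointLaw hσ] with p hp
  have h0 : 0 ≤ p.1 := G.a₁_nonneg.trans hp.1.1
  rw [Real.norm_of_nonneg (mul_nonneg h0 (leaderWinProb_nonneg _ _))]
  exact (mul_le_of_le_one_right h0 (leaderWinProb_le_one _ _)).trans hp.1.2

theorem leaderUtility_eq_jointLaw (hσ : G.IsStrategy σ) : G.leaderUtility σ =
    ((∫ p, p.1 * G.leaderWinProb σ p.2 ∂G.jointLaw σ : ℝ) : EReal) -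
      ((∫⁻ p, ENNReal.ofReal p.2 ∂G.jointLaw σ : ENNReal) : EReal) := by
  have := hσ.markov
  have h := integrable_value_mul_leaderWinProb hσ
  unfold leaderUtility
  unfold jointLaw at h ⊢
  rw [Measure.integral_compProd h, Measure.lintegral_compProd (by fun_prop)]
  simp_rw [integral_const_mul]

theorem integrableOn_sq_equilibriumWinProb_sub (hσ : G.IsStrategy σ) (t₀ : ℝ) :
    IntegrableOn (fun y => (G.equilibriumWinProb σ y - G.F₁ t₀) ^ 2 / 2) (Ioo 0 G.b₂) := by
  have := (monotone_equilibriumWinProb hσ).measurable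
  refine Measure.integrableOn_of_bounded (M := 1) (by simp) (by fun_prop) ?_
  refine Filter.Eventually.of_forall fun y => ?_
  have h1 := equilibriumWinProb_mem (G := G) hσ y
  have h2 : 0 ≤ G.F₁ t₀ := cdf_nonneg _ _
  have h3 : G.F₁ t₀ ≤ 1 := cdf_le_one _ _
  rw [Real.norm_of_nonneg (by positivity)]
  nlinarith [h1.1, h1.2]

/-- The leader's utility is at most that of the threshold bid, up to a quadratic loss that
measures how far the follower's winning probabilities are from `F₁[t₀]`. -/
theorem leaderUtility_le (hf₂ : MonotoneOn G.f₂ (Ioo G.b₁ G.b₂)) (hσ : G.IsStrategy σ) {t₀ : ℝ}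
    (h₀ : G.b₂ - t₀ - G.b₂ * G.F₁ t₀ = 0) :
    G.leaderUtility σ ≤ ((G.thresholdValue t₀ -
      ∫ y in Ioo 0 G.b₂, (G.equilibriumWinProb σ y - G.F₁ t₀) ^ 2 / 2 : ℝ) : EReal) := by
  have := isProbabilityMeasure_jointLaw hσ
  have hb := G.b₂_pos
  rw [leaderUtility_eq_jointLaw hσ]
  by_cases hC : ∫⁻ p, ENNReal.ofReal p.2 ∂G.jointLaw σ = ⊤
  -- With infinite expected bid the utility is `⊥`. Otherwise everything is a real integral.
  · rw [hC]; simp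
  have hnn : 0 ≤ᵐ[G.jointLaw σ] fun p : ℝ × ℝ => p.2 := by
    filter_upwards [ae_mem_jointLaw hσ] with p hp using hp.2
  have hbid : Integrable (fun p : ℝ × ℝ => p.2) (G.jointLaw σ) := by
    refine ⟨measurable_snd.aestronglyMeasurable, ?_⟩
    rw [hasFiniteIntegral_iff_ofReal hnn]
    exact lt_top_iff_ne_top.2 hC
  rw [← EReal.coe_ennreal_toReal hC, ← EReal.coe_sub, EReal.coe_le_coe_iff,
    ← integral_eq_lintegral_of_nonneg_ae hnn measurable_snd.aestronglyMeasurable]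
  have hW := integrable_value_mul_leaderWinProb hσ
  have hK := integrable_typeContribution_uncurry hσ
  have hq := integrableOn_sq_equilibriumWinProb_sub hσ t₀
  have hc : IntegrableOn (fun _ : ℝ => G.thresholdValue t₀ / G.b₂) (Ioo 0 G.b₂) :=
    integrableOn_const (by simp)
  calc ∫ p, p.1 * G.leaderWinProb σ p.2 ∂G.jointLaw σ - ∫ p, p.2 ∂G.jointLaw σ
      = ∫ p, (p.1 * G.leaderWinProb σ p.2 - p.2) ∂G.jointLaw σ := (integral_sub hW hbid).symm
    _ ≤ ∫ p, ∫ y in Ioo 0 G.b₂, G.typeContribution σ y p ∂volume ∂G.jointLaw σ := by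
      refine integral_mono_ae (hW.sub hbid) hK.integral_prod_right ?_
      filter_upwards [ae_mem_jointLaw hσ] with p hp
      exact payoff_le_integral_typeContribution hf₂ hσ (G.a₁_nonneg.trans hp.1.1) hp.2
    _ = ∫ y in Ioo 0 G.b₂, ∫ p, G.typeContribution σ y p ∂G.jointLaw σ :=
      (integral_integral_swap hK).symm
    _ ≤ ∫ y in Ioo 0 G.b₂, (G.thresholdValue t₀ / G.b₂ -
          (G.equilibriumWinProb σ y - G.F₁ t₀) ^ 2 / 2) := by
      refine integral_mono_ae hK.integral_prod_left (hc.sub hq) ?_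
      filter_upwards [hK.prod_right_ae] with y hy
      exact integral_typeContribution_le hσ h₀ hy
    _ = _ := by
      rw [integral_sub hc hq, setIntegral_const, smul_eq_mul, Real.volume_real_Ioo_of_le hb.le,
        sub_zero, mul_div_cancel₀ _ hb.ne']

end AllPayAuction

/-! ### The threshold bid attains the bound. -/

namespace AllPayAuction

variable {G : AllPayAuction} {s : ℝ → ℝ} {t₀ : ℝ}

theorem isStrategy_deterministic (hs : Measurable s) (h : ∀ x ∈ Icc G.a₁ G.a₂, 0 ≤ s x) :
    G.IsStrategy (Kernel.deterministic s hs) where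
  markov := inferInstance
  nonneg x hx := by
    rw [Kernel.deterministic_apply' hs x measurableSet_Iio, indicator_of_notMem]
    simpa using h x hx

theorem followerWinProb_deterministic (hs : Measurable s) (t : ℝ) :
    G.followerWinProb (Kernel.deterministic s hs) t = G.law₁.real {x | s x ≤ t} := by
  unfold followerWinProb bidLaw
  rw [Measure.deterministic_comp_eq_map, map_measureReal_apply hs measurableSet_Iic]
  rfl

theorem leaderUtility_deterministic (hs : Measurable s) :
    G.leaderUtility (Kernel.deterministic s hs) =
      ((∫ x, x * G.leaderWinProb (Kernel.deterministic s hs) (s x) ∂G.law₁ : ℝ) : EReal) -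
        ((∫⁻ x, ENNReal.ofReal (s x) ∂G.law₁ : ENNReal) : EReal) := by
  unfold leaderUtility
  simp_rw [Kernel.deterministic_apply, integral_dirac, lintegral_dirac]

theorem law₁_real_mono {A B : Set ℝ} (h : ∀ x ∈ Icc G.a₁ G.a₂, x ∈ A → x ∈ B) :
    G.law₁.real A ≤ G.law₁.real B := by
  refine ENNReal.toReal_mono (measure_ne_top _ _) (measure_mono_ae ?_)
  filter_upwards [ae_mem_law₁] with x hx using h x hx

theorem F₁_lt_F₁ {x z : ℝ} (hz : z ∈ Ioc G.a₁ G.a₂) (h : x < z) : G.F₁ x < G.F₁ z := by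
  have hm : max x G.a₁ < z := max_lt h hz.1
  exact (monotone_F₁ (le_max_left x G.a₁)).trans_lt
    (strictMonoOn_F₁ ⟨le_max_right _ _, hm.le.trans hz.2⟩ ⟨hz.1.le, hz.2⟩ hm)

theorem thresholdBid_nonneg (x : ℝ) : 0 ≤ G.thresholdBid t₀ x := by
  unfold thresholdBid
  split_ifs with h
  · exact le_rfl
  · exact mul_nonneg G.b₂_pos.le (sub_nonneg.2 (monotone_F₁ (not_le.1 h).le))

theorem measurable_thresholdBid : Measurable (G.thresholdBid t₀) :=
  Measurable.ite measurableSet_Iic measurable_const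
    ((continuous_F₁.measurable.sub_const _).const_mul _)

/-- The bid rises at rate `b₂` in `F₁`, so paying `t` buys at most `t / b₂` more winning
probability, worth at most `t` to a type in `[0, b₂]`. Agreement on `[a₁, a₂]` is enough, which also
covers the bid induced by the step function. -/
theorem followerBid_eq_zero_of_eqOn (hs : Measurable s)
    (h : EqOn s (G.thresholdBid t₀) (Icc G.a₁ G.a₂)) {y : ℝ} (hy : y ∈ Icc 0 G.b₂) :
    G.followerBid (Kernel.deterministic s hs) y = 0 := by
  have hb := G.b₂_pos
  refine followerBid_eq_zero ⟨le_rfl, fun t ht => ?_⟩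
  unfold followerPayoff
  rw [followerWinProb_deterministic, followerWinProb_deterministic]
  have h1 : G.F₁ t₀ ≤ G.law₁.real {x | s x ≤ 0} := by
    rw [F₁_eq_real]
    refine law₁_real_mono fun x hx hxt => ?_
    rw [mem_ofPred_eq, h hx, thresholdBid, if_pos (mem_Iic.1 hxt)]
  have h2 : G.law₁.real {x | s x ≤ t} ≤ G.F₁ t₀ + t / G.b₂ := by
    refine le_trans (law₁_real_mono fun x hx hxt => ?_) (measureReal_setOf_cdf_le G.law₁
      (add_nonneg (cdf_nonneg _ _) (div_nonneg ht hb.le)))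
    change G.F₁ x ≤ G.F₁ t₀ + t / G.b₂
    rw [mem_ofPred_eq, h hx, thresholdBid] at hxt
    split_ifs at hxt with hx0
    · exact (monotone_F₁ hx0).trans (le_add_of_nonneg_right (div_nonneg ht hb.le))
    · have : G.F₁ x - G.F₁ t₀ ≤ t / G.b₂ := (le_div_iff₀ hb).2 (by linarith)
      linarith
  have h3 := mul_le_mul_of_nonneg_left h1 hy.1
  have h4 := mul_le_mul_of_nonneg_left h2 hy.1
  have h5 : y * (t / G.b₂) ≤ t := by
    rw [mul_div_assoc', div_le_iff₀ hb, mul_comm]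
    exact mul_le_mul_of_nonneg_left hy.2 ht
  linarith

theorem leaderWinProb_eq_one_of_eqOn (hs : Measurable s)
    (h : EqOn s (G.thresholdBid t₀) (Icc G.a₁ G.a₂)) {b : ℝ} (hb : 0 < b) :
    G.leaderWinProb (Kernel.deterministic s hs) b = 1 := by
  have hS : G.IsStrategy (Kernel.deterministic s hs) :=
    isStrategy_deterministic hs fun x hx => (h hx).symm ▸ thresholdBid_nonneg x
  unfold leaderWinProb
  rw [measureReal_def, (mem_ae_iff_prob_eq_one (measurableSet_followerBid_lt hS b)).1,
    ENNReal.toReal_one]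
  filter_upwards [ae_mem_law₂] with y hy
  rw [followerBid_eq_zero_of_eqOn hs h ⟨G.b₁_nonneg.trans hy.1, hy.2⟩]
  exact hb

theorem integral_thresholdBid :
    ∫ x, G.thresholdBid t₀ x ∂G.law₁ = G.b₂ * (1 - G.F₁ t₀) ^ 2 / 2 := by
  have e : ∀ x, G.thresholdBid t₀ x = (Ioi t₀).indicator (fun x => G.b₂ *
      (G.law₁.real (Iic x) - G.law₁.real (Iic t₀))) x := by
    intro x
    rw [← F₁_eq_real, thresholdBid]
    by_cases h : x ≤ t₀
    · rw [if_pos h, indicator_of_notMem (by simpa using h)]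
    · rw [if_neg h, indicator_of_mem (by simpa using h), F₁_eq_real x]
  simp_rw [e]
  rw [integral_indicator measurableSet_Ioi, integral_const_mul,
    setIntegral_measureReal_Iic_sub_eq, law₁_real_Ioi]
  ring

theorem integrable_thresholdBid : Integrable (G.thresholdBid t₀) G.law₁ := by
  refine Integrable.of_bound (C := G.b₂) measurable_thresholdBid.aestronglyMeasurable
    (Filter.Eventually.of_forall fun x => ?_)
  rw [Real.norm_of_nonneg (thresholdBid_nonneg x), thresholdBid]
  have hb := G.b₂_pos
  split_ifs
  · exact hb.le
  · refine mul_le_of_le_one_right hb.le ?_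
    have h1 : G.F₁ x ≤ 1 := cdf_le_one _ _
    have h2 : 0 ≤ G.F₁ t₀ := cdf_nonneg _ _
    linarith

/-- Strategies that agree with the threshold bid on `[a₁, a₂]` attain the threshold value. -/
theorem thresholdValue_le_leaderUtility (hs : Measurable s)
    (h : EqOn s (G.thresholdBid t₀) (Icc G.a₁ G.a₂)) :
    ((G.thresholdValue t₀ : ℝ) : EReal) ≤ G.leaderUtility (Kernel.deterministic s hs) := by
  rw [leaderUtility_deterministic]
  have e1 : ∫⁻ x, ENNReal.ofReal (s x) ∂G.law₁ =
      ENNReal.ofReal (G.b₂ * (1 - G.F₁ t₀) ^ 2 / 2) := by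
    rw [← integral_thresholdBid, ofReal_integral_eq_lintegral_ofReal integrable_thresholdBid
      (Filter.Eventually.of_forall thresholdBid_nonneg)]
    refine lintegral_congr_ae ?_
    filter_upwards [ae_mem_law₁] with x hx
    rw [h hx]
  have hnn : 0 ≤ G.b₂ * (1 - G.F₁ t₀) ^ 2 / 2 := by have := G.b₂_pos; positivity
  rw [e1, EReal.coe_ennreal_ofReal, max_eq_left hnn, ← EReal.coe_sub, EReal.coe_le_coe_iff]
  unfold thresholdValue
  refine sub_le_sub_right ?_ _
  rw [← integral_indicator measurableSet_Ioi]
  have hW := (monotone_leaderWinProb (G := G) (Kernel.deterministic s hs)).measurable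
  refine integral_mono_ae (integrable_id_law₁.indicator measurableSet_Ioi) ?_ ?_
  · refine Integrable.mul_bdd (c := 1) integrable_id_law₁
      (hW.comp hs).aestronglyMeasurable (Filter.Eventually.of_forall fun x => ?_)
    rw [Real.norm_of_nonneg (leaderWinProb_nonneg _ _)]
    exact leaderWinProb_le_one _ _
  -- The point `a₁` is discarded: if `t₀ < a₁`, the threshold bid at `a₁` is still `0`.
  · filter_upwards [ae_mem_law₁, measure_eq_zero_iff_ae_notMem.1
      (measure_singleton (μ := G.law₁) G.a₁)] with x hx hxa
    by_cases hxt : t₀ < x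
    · have hx' : x ∈ Ioc G.a₁ G.a₂ := ⟨lt_of_le_of_ne hx.1 (Ne.symm hxa), hx.2⟩
      have hpos : 0 < s x := by
        rw [h hx, thresholdBid, if_neg (not_le.2 hxt)]
        exact mul_pos G.b₂_pos (sub_pos.2 (F₁_lt_F₁ hx' hxt))
      rw [indicator_of_mem (mem_Ioi.2 hxt), leaderWinProb_eq_one_of_eqOn hs h hpos, mul_one]
    · rw [indicator_of_notMem (by simpa using hxt)]
      exact mul_nonneg (G.a₁_nonneg.trans hx.1) (leaderWinProb_nonneg _ _)

end AllPayAuction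

/-! ### The threshold, and the follower's utility in the case of equality. -/

namespace AllPayAuction

variable {G : AllPayAuction} {σ : Kernel ℝ ℝ} {t₀ : ℝ}

/-- The left side is continuous and strictly decreasing in `t`, and changes sign between `0` and
`b₂`. -/
theorem exists_threshold (G : AllPayAuction) :
    ∃ t₀ : ℝ, ∀ t : ℝ, G.b₂ - t - G.b₂ * G.F₁ t = 0 ↔ t = t₀ := by
  have hb := G.b₂_pos
  have hanti : StrictAnti fun t => G.b₂ - t - G.b₂ * G.F₁ t := fun x z hxz => by
    have := mul_le_mul_of_nonneg_left (monotone_F₁ (G := G) hxz.le) hb.le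
    simp only
    linarith
  have hcont : Continuous fun t => G.b₂ - t - G.b₂ * G.F₁ t := by
    have := continuous_F₁ (G := G)
    fun_prop
  have h0 : G.b₂ - 0 - G.b₂ * G.F₁ 0 ≥ 0 := by
    have := mul_le_of_le_one_right hb.le (cdf_le_one G.law₁ 0)
    unfold F₁
    linarith
  have h1 : G.b₂ - G.b₂ - G.b₂ * G.F₁ G.b₂ ≤ 0 := by
    have := mul_nonneg hb.le (cdf_nonneg G.law₁ G.b₂)
    unfold F₁
    linarith
  obtain ⟨t₀, -, ht₀⟩ := intermediate_value_Icc' hb.le hcont.continuousOn ⟨h1, h0⟩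
  exact ⟨t₀, fun t => ⟨fun ht => hanti.injective (ht.trans ht₀.symm), fun ht => ht ▸ ht₀⟩⟩

theorem threshold_mem (h₀ : G.b₂ - t₀ - G.b₂ * G.F₁ t₀ = 0) (h : G.a₁ ≤ G.b₂) :
    t₀ ∈ Ico G.a₁ G.a₂ := by
  constructor <;> by_contra! hlt
  · rw [F₁_of_le hlt.le] at h₀
    linarith
  · rw [F₁_of_ge hlt] at h₀
    linarith [G.a₁_nonneg, G.a₁_lt_a₂]

theorem threshold_of_uniform (h₀ : G.b₂ - t₀ - G.b₂ * G.F₁ t₀ = 0) (ht : t₀ ∈ Ico G.a₁ G.a₂)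
    (hu : G.law₁ = ProbabilityTheory.cond volume (Icc G.a₁ G.a₂)) :
    t₀ = G.b₂ * G.a₂ / (G.b₂ + G.a₂ - G.a₁) := by
  have ha := G.a₁_lt_a₂
  have hb := G.b₂_pos
  have hF : G.F₁ t₀ = (t₀ - G.a₁) / (G.a₂ - G.a₁) := by
    have hi : Icc G.a₁ G.a₂ ∩ Iic t₀ = Icc G.a₁ t₀ := by
      ext x
      exact ⟨fun hx => ⟨hx.1.1, hx.2⟩, fun hx => ⟨⟨hx.1, hx.2.trans ht.2.le⟩, hx.2⟩⟩
    rw [F₁_eq_real, hu, measureReal_def, cond_apply measurableSet_Icc, hi, ENNReal.toReal_mul,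
      ENNReal.toReal_inv, Real.volume_Icc, Real.volume_Icc, ENNReal.toReal_ofReal (by linarith),
      ENNReal.toReal_ofReal (by linarith [ht.1])]
    ring
  have hne : G.a₂ - G.a₁ ≠ 0 := by linarith
  rw [hF] at h₀
  field_simp at h₀
  rw [eq_div_iff (by linarith)]
  linarith

/-- Attaining the bound forces the quadratic loss to vanish, so `q = F₁ t₀` almost everywhere on
`(0, b₂)`. The envelope formula turns this into an identity at every type. -/
theorem followerUtility_eq_of_thresholdValue_le (hf₂ : MonotoneOn G.f₂ (Ioo G.b₁ G.b₂))
    (hσ : G.IsStrategy σ) (h₀ : G.b₂ - t₀ - G.b₂ * G.F₁ t₀ = 0)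
    (h : ((G.thresholdValue t₀ : ℝ) : EReal) ≤ G.leaderUtility σ) {y : ℝ} (hy : y ∈ Icc 0 G.b₂) :
    G.followerUtility σ y = y * G.F₁ t₀ := by
  have h1 := h.trans (leaderUtility_le hf₂ hσ h₀)
  rw [EReal.coe_le_coe_iff] at h1
  have hnn : ∀ y, 0 ≤ (G.equilibriumWinProb σ y - G.F₁ t₀) ^ 2 / 2 := fun y => by positivity
  have h2 : ∫ y in Ioo 0 G.b₂, (G.equilibriumWinProb σ y - G.F₁ t₀) ^ 2 / 2 = 0 :=
    le_antisymm (by linarith) (integral_nonneg hnn)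
  rw [integral_eq_zero_iff_of_nonneg hnn (integrableOn_sq_equilibriumWinProb_sub hσ t₀)] at h2
  rw [← integral_equilibriumWinProb hσ hy.1, intervalIntegral.integral_of_le hy.1,
    integral_Ioc_eq_integral_Ioo]
  have h3 : ∀ᵐ z ∂volume.restrict (Ioo 0 y), G.equilibriumWinProb σ z = G.F₁ t₀ := by
    filter_upwards [ae_restrict_of_ae_restrict_of_subset (Ioo_subset_Ioo_right hy.2) h2] with z hz
    have hz : (G.equilibriumWinProb σ z - G.F₁ t₀) ^ 2 / 2 = 0 := hz
    exact sub_eq_zero.1 (pow_eq_zero_iff two_ne_zero |>.1 (by linarith))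
  rw [integral_congr_ae h3, setIntegral_const, smul_eq_mul, Real.volume_real_Ioo_of_le hy.1,
    sub_zero]

/-! ### Feasible functions, their induced bids, and uniqueness. -/

theorem isFeasible_stepFunction (G : AllPayAuction) (t₀ : ℝ) :
    G.IsFeasible (G.stepFunction t₀) where
  mem x _ := by
    have hb := G.b₂_pos
    unfold stepFunction
    split_ifs
    exacts [left_mem_Icc.2 hb.le, right_mem_Icc.2 hb.le]
  mono x _ z _ hxz := by
    have hb := G.b₂_pos
    unfold stepFunction
    split_ifs <;> linarith
  left_cont x _ := by
    by_cases h : x ≤ t₀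
    · refine continuousWithinAt_const (b := (0 : ℝ)) |>.congr (fun z hz => ?_) ?_
      · exact if_pos (le_trans hz h)
      · exact if_pos h
    · refine ContinuousAt.continuousWithinAt ?_
      refine (continuousAt_const (y := G.b₂)).congr ?_
      filter_upwards [Ioi_mem_nhds (not_le.1 h)] with z hz
      exact (if_neg (not_le.2 hz)).symm

theorem intervalIntegral_f₁ {x z : ℝ} (h : x ≤ z) : ∫ t in x..z, G.f₁ t = G.F₁ z - G.F₁ x := by
  rw [intervalIntegral.integral_of_le h, setIntegral_f₁ measurableSet_Ioc, law₁_real_Ioc h]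

theorem inducedBid_stepFunction {x : ℝ} (hx : x ∈ Icc G.a₁ G.a₂) :
    G.inducedBid (G.stepFunction t₀) x = G.thresholdBid t₀ x := by
  have e : ∀ t, G.f₁ t * G.stepFunction t₀ t = (Ioi t₀).indicator (fun t => G.f₁ t * G.b₂) t := by
    intro t
    unfold stepFunction
    by_cases h : t ≤ t₀
    · rw [if_pos h, indicator_of_notMem (by simpa using h), mul_zero]
    · rw [if_neg h, indicator_of_mem (by simpa using h)]
  unfold inducedBid
  simp_rw [e]
  rw [intervalIntegral.integral_of_le hx.1, setIntegral_indicator measurableSet_Ioi,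
    Ioc_inter_Ioi, integral_mul_const, setIntegral_f₁ measurableSet_Ioc, thresholdBid]
  split_ifs with h
  · rw [Ioc_eq_empty (not_lt.2 (h.trans (le_max_right _ _))), measureReal_empty, zero_mul]
  · rw [law₁_real_Ioc (max_le hx.1 (not_le.1 h).le), mul_comm]
    rcases le_total G.a₁ t₀ with h1 | h1
    · rw [max_eq_right h1]
    -- A threshold below `a₁` is harmless, since `F₁` vanishes at both points.
    · rw [max_eq_left h1, F₁_of_le h1, F₁_of_le le_rfl]

variable {g : ℝ → ℝ}

theorem IsFeasible.intervalIntegrable (hg : G.IsFeasible g) {x z : ℝ} (hx : x ∈ Icc G.a₁ G.a₂)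
    (hz : z ∈ Icc G.a₁ G.a₂) : IntervalIntegrable (fun t => G.f₁ t * g t) volume x z := by
  have hI : IntegrableOn (fun t => G.f₁ t * g t) (Ioc G.a₁ G.a₂) := by
    refine Integrable.mul_bdd (c := G.b₂) integrable_f₁.integrableOn ?_ ?_
    · exact (aemeasurable_restrict_of_monotoneOn measurableSet_Ioc hg.mono).aestronglyMeasurable
    · refine (ae_restrict_iff' measurableSet_Ioc).2 (Filter.Eventually.of_forall fun x hx => ?_)
      rw [Real.norm_eq_abs, abs_of_nonneg (hg.mem x hx).1]
      exact (hg.mem x hx).2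
  rw [intervalIntegrable_iff]
  refine hI.mono_set fun t ht => ⟨?_, ?_⟩
  · exact (le_min hx.1 hz.1).trans_lt ht.1
  · exact ht.2.trans (max_le hx.2 hz.2)

theorem left_mem (G : AllPayAuction) : G.a₁ ∈ Icc G.a₁ G.a₂ := left_mem_Icc.2 G.a₁_lt_a₂.le

theorem IsFeasible.inducedBid_add (hg : G.IsFeasible g) {x z : ℝ} (hx : x ∈ Icc G.a₁ G.a₂)
    (hz : z ∈ Icc G.a₁ G.a₂) :
    G.inducedBid g x + ∫ t in x..z, G.f₁ t * g t = G.inducedBid g z :=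
  intervalIntegral.integral_add_adjacent_intervals (hg.intervalIntegrable G.left_mem hx)
    (hg.intervalIntegrable hx hz)

/-- The induced bid is convex as a function of `F₁`, with subgradient `g`. -/
theorem IsFeasible.inducedBid_subgradient (hg : G.IsFeasible g) {x z : ℝ}
    (hx : x ∈ Ioc G.a₁ G.a₂) (hz : z ∈ Icc G.a₁ G.a₂) :
    G.inducedBid g x + g x * (G.F₁ z - G.F₁ x) ≤ G.inducedBid g z := by
  have hx' : x ∈ Icc G.a₁ G.a₂ := ⟨hx.1.le, hx.2⟩
  have hfi : ∀ a b, IntervalIntegrable (fun t => G.f₁ t * g x) volume a b := fun a b =>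
    (integrable_f₁.mul_const _).intervalIntegrable
  rcases le_total x z with h | h
  · have h1 : ∫ t in x..z, G.f₁ t * g x ≤ ∫ t in x..z, G.f₁ t * g t := by
      refine intervalIntegral.integral_mono_on_of_le_Ioo h (hfi _ _)
        (hg.intervalIntegrable hx' hz) fun t ht => ?_
      exact mul_le_mul_of_nonneg_left
        (hg.mono hx ⟨hx.1.trans ht.1, ht.2.le.trans hz.2⟩ ht.1.le) (G.f₁_nonneg t)
    rw [intervalIntegral.integral_mul_const, intervalIntegral_f₁ h] at h1
    linarith [hg.inducedBid_add hx' hz]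
  · have h1 : ∫ t in z..x, G.f₁ t * g t ≤ ∫ t in z..x, G.f₁ t * g x := by
      refine intervalIntegral.integral_mono_on_of_le_Ioo h
        (hg.intervalIntegrable hz hx') (hfi _ _) fun t ht => ?_
      exact mul_le_mul_of_nonneg_left
        (hg.mono ⟨hz.1.trans_lt ht.1, ht.2.le.trans hx.2⟩ hx ht.2.le) (G.f₁_nonneg t)
    rw [intervalIntegral.integral_mul_const, intervalIntegral_f₁ h] at h1
    linarith [hg.inducedBid_add hz hx']

theorem inducedBid_left (g : ℝ → ℝ) : G.inducedBid g G.a₁ = 0 := intervalIntegral.integral_same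

theorem IsFeasible.monotoneOn_inducedBid (hg : G.IsFeasible g) :
    MonotoneOn (G.inducedBid g) (Icc G.a₁ G.a₂) := by
  intro x hx z hz hxz
  -- At `a₁` the value of `g` is unconstrained and gives no subgradient, so this endpoint is treated
  -- by the sign of the integrand.
  rcases eq_or_lt_of_le hx.1 with h | h
  · rw [← h, inducedBid_left]
    refine intervalIntegral.integral_nonneg_of_ae_restrict hz.1 ?_
    rw [Filter.EventuallyLE, ae_restrict_iff' measurableSet_Icc]
    filter_upwards [Measure.ae_ne volume G.a₁] with t ht1 ht
    exact mul_nonneg (G.f₁_nonneg t)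
      (hg.mem t ⟨lt_of_le_of_ne ht.1 (Ne.symm ht1), ht.2.trans hz.2⟩).1
  · have h1 := hg.inducedBid_subgradient ⟨h, hx.2⟩ hz
    have h2 := mul_nonneg (hg.mem x ⟨h, hx.2⟩).1 (sub_nonneg.2 (monotone_F₁ (G := G) hxz))
    linarith

theorem IsFeasible.inducedBid_nonneg (hg : G.IsFeasible g) {x : ℝ} (hx : x ∈ Icc G.a₁ G.a₂) :
    0 ≤ G.inducedBid g x := by
  rw [← inducedBid_left (G := G) g]
  exact hg.monotoneOn_inducedBid G.left_mem hx hx.1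

theorem isStrategy_inducedStrategy (hg : G.IsFeasible g) : G.IsStrategy (inducedStrategy hg) :=
  isStrategy_deterministic _ fun _ hx => hg.inducedBid_nonneg hx

/-- By the subgradient inequality, a bid at most `t` forces `F₁ ≤ F₁ x + (t - s_g(x)) / g x`. Since
`F₁` of the valuation is stochastically at least uniform, this caps the winning probability from any
deviation. -/
theorem followerUtility_inducedStrategy_le (hg : G.IsFeasible g) {x : ℝ}
    (hx : x ∈ Ioc G.a₁ G.a₂) :
    G.followerUtility (inducedStrategy hg) (g x) ≤ g x * G.F₁ x - G.inducedBid g x := by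
  refine followerUtility_le_of_forall fun t ht => ?_
  unfold inducedStrategy
  rw [followerWinProb_deterministic]
  have hsub : ∀ z ∈ Icc G.a₁ G.a₂, G.inducedBid g x + g x * (G.F₁ z - G.F₁ x) ≤ G.inducedBid g z :=
    fun z hz => hg.inducedBid_subgradient hx hz
  have hleft := hsub _ G.left_mem
  rw [inducedBid_left, F₁_of_le le_rfl] at hleft
  rcases eq_or_lt_of_le (hg.mem x hx).1 with h0 | h0
  · rw [← h0] at hleft ⊢
    linarith
  -- The subgradient inequality at `a₁` gives `s_g(x) ≤ g x * F₁ x`.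
  · have hc : 0 ≤ G.F₁ x + (t - G.inducedBid g x) / g x := by
      rw [← sub_le_iff_le_add', zero_sub, le_div_iff₀ h0]
      linarith
    have h1 : G.law₁.real {z | G.inducedBid g z ≤ t} ≤
        G.F₁ x + (t - G.inducedBid g x) / g x := by
      refine le_trans (law₁_real_mono fun z hz hzt => ?_) (measureReal_setOf_cdf_le G.law₁ hc)
      change G.F₁ z ≤ _
      rw [← sub_le_iff_le_add', le_div_iff₀ h0]
      have : G.inducedBid g z ≤ t := hzt
      linarith [hsub z hz]
    have h2 := mul_le_mul_of_nonneg_left h1 h0.le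
    rw [mul_add, mul_div_cancel₀ _ h0.ne'] at h2
    linarith

theorem F₁_le_followerWinProb_inducedBid (hg : G.IsFeasible g) {x : ℝ}
    (hx : x ∈ Icc G.a₁ G.a₂) :
    G.F₁ x ≤ G.followerWinProb (inducedStrategy hg) (G.inducedBid g x) := by
  unfold inducedStrategy
  rw [followerWinProb_deterministic, F₁_eq_real]
  exact law₁_real_mono fun z hz hzx => hg.monotoneOn_inducedBid hz hx hzx

/-- With `u_B(y) = y F₁(t₀)`, type `g x` yields `0 ≤ s_g(x) ≤ g x * (F₁ x - F₁ t₀)`, which forces `g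
x = 0` below `t₀`. Above `t₀`, the option of type `b₂` to bid `s_g(x)` yields `b₂ * (F₁ x - F₁ t₀) ≤
s_g(x)`, which forces `g x = b₂`. -/
theorem eqOn_stepFunction_of_thresholdValue_le (hf₂ : MonotoneOn G.f₂ (Ioo G.b₁ G.b₂))
    (h₀ : G.b₂ - t₀ - G.b₂ * G.F₁ t₀ = 0) (hg : G.IsFeasible g)
    (h : ((G.thresholdValue t₀ : ℝ) : EReal) ≤ G.leaderUtility (inducedStrategy hg)) :
    EqOn g (G.stepFunction t₀) (Ioc G.a₁ G.a₂) := by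
  have hb := G.b₂_pos
  have hS := isStrategy_inducedStrategy hg
  have hu : ∀ y ∈ Icc 0 G.b₂, G.followerUtility (inducedStrategy hg) y = y * G.F₁ t₀ :=
    fun y hy => followerUtility_eq_of_thresholdValue_le hf₂ hS h₀ h hy
  have hkey : ∀ x ∈ Ioc G.a₁ G.a₂, G.inducedBid g x ≤ g x * (G.F₁ x - G.F₁ t₀) := fun x hx => by
    have h1 := followerUtility_inducedStrategy_le hg hx
    rw [hu _ (hg.mem x hx)] at h1
    linarith
  have hlow : ∀ x ∈ Ioc G.a₁ G.a₂, x < t₀ → g x = 0 := fun x hx hxt => by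
    have h1 := hkey x hx
    have h2 := hg.inducedBid_nonneg (Ioc_subset_Icc_self hx)
    have h4 := (hg.mem x hx).1
    have h3 : G.F₁ x < G.F₁ t₀ := by
      rcases le_total t₀ G.a₂ with h5 | h5
      · exact F₁_lt_F₁ ⟨hx.1.trans hxt, h5⟩ hxt
      · have h6 : G.F₁ t₀ = 1 := F₁_of_ge h5
        -- The equation would give `t₀ = 0`, which is impossible for `0 ≤ a₁ < x < t₀`.
        rw [h6] at h₀
        linarith [hx.1, G.a₁_nonneg]
    nlinarith
  intro x hx
  have hx' := Ioc_subset_Icc_self hx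
  unfold stepFunction
  split_ifs with hxt
  · rcases eq_or_lt_of_le hxt with heq | hlt
    · have h1 : Filter.Tendsto g (nhdsWithin x (Iio x)) (nhds (g x)) :=
        (hg.left_cont x hx).mono Iio_subset_Iic_self
      refine tendsto_nhds_unique (h1.congr' ?_) tendsto_const_nhds
      filter_upwards [Ioo_mem_nhdsLT hx.1] with z hz
      exact hlow z ⟨hz.1, hz.2.le.trans hx.2⟩ (heq ▸ hz.2)
    · exact hlow x hx hlt
  · have h1 := hkey x hx
    have h2 := followerPayoff_le_followerUtility hS hb.le (hg.inducedBid_nonneg hx')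
    rw [hu _ (right_mem_Icc.2 hb.le)] at h2
    have h3 := mul_le_mul_of_nonneg_left (F₁_le_followerWinProb_inducedBid hg hx') hb.le
    have h4 := F₁_lt_F₁ hx (not_le.1 hxt)
    exact le_antisymm (hg.mem x hx).2 (le_of_mul_le_mul_right (by linarith) (sub_pos.2 h4))

/-- At fixed `x` the equal-utility curves are linear in `y` with slope `F₁ x - F₁ t₀`, so the sign
of the slope selects the endpoint `0` or `b₂`. At slope zero, taking the least maximizer gives `0`.
-/
theorem smoothed_and_equalBidTypes_of_followerUtility (hu : ∀ y ∈ Icc 0 G.b₂, G.followerUtility σ y =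
    y * G.F₁ t₀) {x : ℝ} (hx : x ∈ Ioc G.a₁ G.a₂) :
    G.smoothed σ x = G.thresholdBid t₀ x ∧
      IsLeast (G.equalBidTypes σ x) (G.stepFunction t₀ x) := by
  have hb := G.b₂_pos
  have he : ∀ y ∈ Icc 0 G.b₂, G.equalUtility σ y x = y * (G.F₁ x - G.F₁ t₀) := fun y hy => by
    rw [equalUtility, hu y hy]
    ring
  have hmem := (isFeasible_stepFunction G t₀).mem x hx
  have hstep : G.stepFunction t₀ x * (G.F₁ x - G.F₁ t₀) = G.thresholdBid t₀ x := by
    unfold stepFunction thresholdBid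
    split_ifs <;> simp
  have hmax : ∀ y ∈ Icc 0 G.b₂, y * (G.F₁ x - G.F₁ t₀) ≤ G.thresholdBid t₀ x := fun y hy => by
    unfold thresholdBid
    split_ifs with h
    · exact mul_nonpos_of_nonneg_of_nonpos hy.1 (sub_nonpos.2 (monotone_F₁ h))
    · exact mul_le_mul_of_nonneg_right hy.2 (sub_nonneg.2 (monotone_F₁ (not_le.1 h).le))
  have hs : G.smoothed σ x = G.thresholdBid t₀ x := by
    refine IsGreatest.csSup_eq ⟨⟨_, hmem, ?_⟩, ?_⟩
    · exact (he _ hmem).trans hstep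
    · rintro _ ⟨y, hy, rfl⟩
      exact (he y hy).trans_le (hmax y hy)
  refine ⟨hs, ⟨hmem, by rw [hs, he _ hmem, hstep]⟩, ?_⟩
  rintro y ⟨hy, hys⟩
  rw [hs, he y hy, ← hstep] at hys
  unfold stepFunction at hys ⊢
  split_ifs at hys ⊢ with h
  · exact hy.1
  · exact (mul_right_cancel₀ (sub_pos.2 (F₁_lt_F₁ hx (not_le.1 h))).ne' hys).ge

end AllPayAuction

/-! ### Assembly of the theorem. -/

theorem mainTheorem9 (G : AllPayAuction) (hf₂ : MonotoneOn G.f₂ (Ioo G.b₁ G.b₂)) :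
    ∃ t₀ : ℝ,
      (∀ t : ℝ, G.b₂ - t - G.b₂ * G.F₁ t = 0 ↔ t = t₀) ∧
      (G.a₁ ≤ G.b₂ → t₀ ∈ Ico G.a₁ G.a₂) ∧
      (G.a₁ ≤ G.b₂ → G.law₁ = ProbabilityTheory.cond volume (Icc G.a₁ G.a₂) →
        t₀ = G.b₂ * G.a₂ / (G.b₂ + G.a₂ - G.a₁)) ∧
      (∃ hg : G.IsFeasible (G.stepFunction t₀),
        (∀ x ∈ Icc G.a₁ G.a₂, G.inducedBid (G.stepFunction t₀) x = G.thresholdBid t₀ x) ∧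
        ∀ (g : ℝ → ℝ) (hg' : G.IsFeasible g),
          G.leaderUtility (AllPayAuction.inducedStrategy hg') ≤
            G.leaderUtility (AllPayAuction.inducedStrategy hg) ∧
          (G.leaderUtility (AllPayAuction.inducedStrategy hg') =
              G.leaderUtility (AllPayAuction.inducedStrategy hg) →
            EqOn g (G.stepFunction t₀) (Ioc G.a₁ G.a₂))) ∧
      (∃ hs : Measurable (G.thresholdBid t₀),
        G.IsOptimalCommitment (Kernel.deterministic (G.thresholdBid t₀) hs)) ∧
      (∀ σ : Kernel ℝ ℝ, G.IsOptimalCommitment σ →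
        EqOn (G.smoothed σ) (G.thresholdBid t₀) (Ioc G.a₁ G.a₂) ∧
        G.IsEqualBidFunctionOf σ (G.stepFunction t₀)) := by
  obtain ⟨t₀, ht₀⟩ := G.exists_threshold
  have h₀ : G.b₂ - t₀ - G.b₂ * G.F₁ t₀ = 0 := (ht₀ t₀).2 rfl
  have hle : ∀ τ, G.IsStrategy τ → G.leaderUtility τ ≤ ((G.thresholdValue t₀ : ℝ) : EReal) := by
    intro τ hτ
    refine (AllPayAuction.leaderUtility_le hf₂ hτ h₀).trans (EReal.coe_le_coe_iff.2 ?_)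
    exact sub_le_self _ (integral_nonneg fun y => by positivity)
  have hopt : G.IsOptimalCommitment (Kernel.deterministic (G.thresholdBid t₀)
      AllPayAuction.measurable_thresholdBid) :=
    ⟨AllPayAuction.isStrategy_deterministic _ fun x _ => AllPayAuction.thresholdBid_nonneg x,
      fun τ hτ => (hle τ hτ).trans
        (AllPayAuction.thresholdValue_le_leaderUtility _ (eqOn_refl _ _))⟩
  have hstep : ((G.thresholdValue t₀ : ℝ) : EReal) ≤ G.leaderUtility
      (AllPayAuction.inducedStrategy (AllPayAuction.isFeasible_stepFunction G t₀)) :=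
    AllPayAuction.thresholdValue_le_leaderUtility _
      fun x hx => AllPayAuction.inducedBid_stepFunction hx
  refine ⟨t₀, ht₀, AllPayAuction.threshold_mem h₀, fun hab hu =>
    AllPayAuction.threshold_of_uniform h₀ (AllPayAuction.threshold_mem h₀ hab) hu,
    ⟨AllPayAuction.isFeasible_stepFunction G t₀,
      fun x hx => AllPayAuction.inducedBid_stepFunction hx, fun g hg' => ⟨?_, fun heq => ?_⟩⟩,
    ⟨_, hopt⟩, fun σ hσ => ?_⟩
  · exact (hle _ (AllPayAuction.isStrategy_inducedStrategy hg')).trans hstep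
  · exact AllPayAuction.eqOn_stepFunction_of_thresholdValue_le hf₂ h₀ hg' (heq ▸ hstep)
  · have hu : ∀ y ∈ Icc 0 G.b₂, G.followerUtility σ y = y * G.F₁ t₀ := fun y hy =>
      AllPayAuction.followerUtility_eq_of_thresholdValue_le hf₂ hσ.1 h₀
        ((AllPayAuction.thresholdValue_le_leaderUtility _ (eqOn_refl _ _)).trans
          (hσ.2 _ hopt.1)) hy
    exact ⟨fun x hx => (AllPayAuction.smoothed_and_equalBidTypes_of_followerUtility hu hx).1,
      fun x hx => (AllPayAuction.smoothed_and_equalBidTypes_of_followerUtility hu hx).2⟩
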